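/- **Conventions.** All Hilbert spaces $\mathcal H_A,\mathcal H_B,\mathcal H_C$ are finite-dimensional, $\log$ is the logarithm to base $2$ with $\log 0=-\infty$, and $\mathcal S_\le(\mathcal H)$ is the set of positive semidefinite operators $\rho$ on $\mathcal H$ with $\operatorname{tr}\rho\le 1$. For positive semidefinite $\rho,\sigma$ put $F(\rho,\sigma)=\|\sqrt\rho\sqrt\sigma\|_1$, where $\|X\|_1=\operatorname{tr}\sqrt{X^\dagger X}$. For $\rho,\sigma\in\mathcal S_\le(\mathcal H)$ let $$P(\rho,\sigma)=\sqrt{1-\bar F(\rho,\sigma)^2},\qquad \bar F(\rho,\sigma)=F(\rho,\sigma)+\sqrt{(1-\operatorname{tr}\rho)(1-\operatorname{tr}\sigma)}$$ be the purified distance. For $\rho_{AB}\in\mathcal S_\le(\mathcal H_A\otimes\mathcal H_B)$ define, with values in $[-\infty,\infty]$, $$H_{\min}(A|B)_\rho=\sup_{\sigma_B\in\mathcal S_\le(\mathcal H_B)}\sup\{\lambda\in\mathbb R:\rho_{AB}\le 2^{-\lambda}\,\mathrm{id}_A\otimes\sigma_B\},$$ $$H_{\max}(A|B)_\rho=\sup_{\sigma_B\in\mathcal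 S_\le(\mathcal H_B)}\log F(\rho_{AB},\mathrm{id}_A\otimes\sigma_B)^2,$$ and for $\delta\ge 0$ $$H_{\min}^{\delta}(A|B)_\rho=\sup_{\tilde\rho}H_{\min}(A|B)_{\tilde\rho},\qquad H_{\max}^{\delta}(A|B)_\rho=\inf_{\tilde\rho}H_{\max}(A|B)_{\tilde\rho},$$ where $\tilde\rho$ ranges over the states in $\mathcal S_\le(\mathcal H_A\otimes\mathcal H_B)$ with $P(\tilde\rho,\rho_{AB})\le\delta$. If $\rho_{ABC}$ is given, entropies of subsystems refer to its marginals. **Theorem.** Let $\varepsilon>0$, $\varepsilon',\varepsilon''\ge 0$ and $\rho_{ABC}\in\mathcal S_\le(\mathcal H_A\otimes\mathcal H_B\otimes\mathcal H_C)$. Let $f(\varepsilon)=\log\frac{1}{1-\sqrt{1-\varepsilon^2}}$ for $\varepsilon\le 1$ and $f(\varepsilon)=0$ for $\varepsilon>1$. Then $$H_{\min}^{\varepsilon+\varepsilon'+2\varepsilon''}(AB|C)_\rho\ \ge\ H_{\min}^{\varepsilon''}(A|BC)_\rho+H_{\min}^{\varepsilon'}(B|C)_\rho-f(\varepsilon)$$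 and $$H_{\max}^{\varepsilon+\varepsilon'+2\varepsilon''}(AB|C)_\rho\ \le\ H_{\max}^{\varepsilon'}(A|BC)_\rho+H_{\max}^{\varepsilon''}(B|C)_\rho+f(\varepsilon).$$ -/

import Mathlib

open scoped Matrix Kronecker MatrixOrder ComplexOrder

noncomputable section

namespace SmoothEntropy

/-- The base-two logarithm of a nonnegative real as an extended real, with `log 0 = -∞`. -/
def log2 (x : ℝ) : EReal := if 0 < x then ((Real.logb 2 x : ℝ) : EReal) else ⊥

/-- A positive semidefinite operator of trace at most one.  Operators on the finite-dimensional
Hilbert space with orthonormal basis indexed by `n` are matrices over `n`; the tensor product of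
two spaces has the product index type. -/
def IsSubnormalized {n : Type*} [Fintype n] (ρ : Matrix n n ℂ) : Prop :=
  ρ.PosSemidef ∧ ρ.trace.re ≤ 1

/-- The trace norm `tr √(X† X)`. -/
def traceNorm {n : Type*} [Fintype n] [DecidableEq n] (X : Matrix n n ℂ) : ℝ :=
  (CFC.sqrt (Xᴴ * X)).trace.re

/-- The fidelity `‖√ρ √σ‖₁` of positive semidefinite operators. -/
def fidelity {n : Type*} [Fintype n] [DecidableEq n] (ρ σ : Matrix n n ℂ) : ℝ :=
  traceNorm (CFC.sqrt ρ * CFC.sqrt σ)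

/-- The generalized fidelity of subnormalized states. -/
def genFidelity {n : Type*} [Fintype n] [DecidableEq n] (ρ σ : Matrix n n ℂ) : ℝ :=
  fidelity ρ σ + Real.sqrt ((1 - ρ.trace.re) * (1 - σ.trace.re))

/-- The purified distance of subnormalized states. -/
def purifiedDist {n : Type*} [Fintype n] [DecidableEq n] (ρ σ : Matrix n n ℂ) : ℝ :=
  Real.sqrt (1 - genFidelity ρ σ ^ 2)

/-- The partial trace over the first tensor factor. -/
def traceFirst {a b : Type*} [Fintype a] (ρ : Matrix (a × b) (a × b) ℂ) : Matrix b b ℂ :=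
  Matrix.of fun i j => ∑ k, ρ (k, i) (k, j)

/-- An operator on `A ⊗ (B ⊗ C)` regarded as an operator on `(A ⊗ B) ⊗ C`. -/
def regroup {a b c : Type*} (ρ : Matrix (a × b × c) (a × b × c) ℂ) :
    Matrix ((a × b) × c) ((a × b) × c) ℂ :=
  ρ.submatrix (Equiv.prodAssoc a b c) (Equiv.prodAssoc a b c)

section Entropies

variable {a b : Type*} [Fintype a] [DecidableEq a] [Fintype b] [DecidableEq b]

/-- `H_min(A|B)_{ρ|σ}`: the supremum of the real `l` with `ρ ≤ 2^{-l} (1 ⊗ σ)` in the Loewner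
order, as an extended real. -/
def minEntropyRel (ρ : Matrix (a × b) (a × b) ℂ) (σ : Matrix b b ℂ) : EReal :=
  sSup ((fun l : ℝ => (l : EReal)) ''
    {l : ℝ | ρ ≤ ((2 : ℝ) ^ (-l)) • ((1 : Matrix a a ℂ) ⊗ₖ σ)})

/-- The conditional min-entropy `H_min(A|B)_ρ`. -/
def minEntropy (ρ : Matrix (a × b) (a × b) ℂ) : EReal :=
  sSup {h : EReal | ∃ σ : Matrix b b ℂ, IsSubnormalized σ ∧ h = minEntropyRel ρ σ}

/-- `H_max(A|B)_{ρ|σ} = log F(ρ, 1 ⊗ σ)²`. -/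
def maxEntropyRel (ρ : Matrix (a × b) (a × b) ℂ) (σ : Matrix b b ℂ) : EReal :=
  log2 (fidelity ρ ((1 : Matrix a a ℂ) ⊗ₖ σ) ^ 2)

/-- The conditional max-entropy `H_max(A|B)_ρ`. -/
def maxEntropy (ρ : Matrix (a × b) (a × b) ℂ) : EReal :=
  sSup {h : EReal | ∃ σ : Matrix b b ℂ, IsSubnormalized σ ∧ h = maxEntropyRel ρ σ}

/-- The smooth conditional min-entropy `H_min^ε(A|B)_ρ`. -/
def smoothMinEntropy (ε : ℝ) (ρ : Matrix (a × b) (a × b) ℂ) : EReal :=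
  sSup {h : EReal | ∃ τ : Matrix (a × b) (a × b) ℂ,
    IsSubnormalized τ ∧ purifiedDist τ ρ ≤ ε ∧ h = minEntropy τ}

/-- The smooth conditional max-entropy `H_max^ε(A|B)_ρ`. -/
def smoothMaxEntropy (ε : ℝ) (ρ : Matrix (a × b) (a × b) ℂ) : EReal :=
  sInf {h : EReal | ∃ τ : Matrix (a × b) (a × b) ℂ,
    IsSubnormalized τ ∧ purifiedDist τ ρ ≤ ε ∧ h = maxEntropy τ}

end Entropies

/-- The error term `f(ε) = log₂ (1 / (1 - √(1 - ε²)))`.  For `ε > 1` the real square root is `0`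
and the value is `0`; there every subnormalized state is `ε`-close to every other one. -/
def errorTerm (ε : ℝ) : ℝ := Real.logb 2 (1 / (1 - Real.sqrt (1 - ε ^ 2)))

end SmoothEntropy

end

set_option linter.unusedSectionVars false

namespace SmoothEntropy

open scoped Pointwise

/-! ### Loewner order and positive square roots -/

section Order

variable {n m : Type*} [Fintype n] [Fintype m]

/-! States are handled through amplitudes: `X` is an amplitude of `X * Xᴴ`, its columns indexing a
purifying system. Taking a marginal or passing to the complementary marginal only rearranges the
entries of `X`, so overlaps are unchanged. Uhlmann's theorem holds with contractions on the
purifying system in place of unitaries.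

The min-entropy rule rests on `exists_close_le_one_kronecker`. Let `ρ ≤ c (1 ⊗ σ)`, let `Z` be an
amplitude of the marginal of `ρ`, and let `Y` satisfy `Y Yᴴ ≤ τ` and lie close to `Z`. The filter `Q
= Zᴴ (Z Zᴴ + δ σ')⁻¹ Z`, where `σ ≤ 2 σ'`, acts on the purifying system, yet `Y Q = T Z` with `T`
acting on the conditioning system. The state with amplitude `Y Q` is therefore `(1 ⊗ T) ρ (1 ⊗ T)ᴴ ≤
c (1 ⊗ T σ Tᴴ)`, and `Q - Q² ≤ 1/4` bounds `T σ Tᴴ` by `τ / δ`. Since `Q` is a contraction, `Y Q` is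
as close to `Z Q` as `Y` is to `Z`, while `Z Q` has fidelity at least `1 - δ` with `Z`. The choice
`δ = 1 - √(1 - ε²)` gives distance `ε` at cost `f(ε)`. Inserting `τ ≤ 2^{-m} (1 ⊗ κ)` yields the
chain rule.

The max-entropy rule is its dual. For a purification on `ABCK`, `H_max(A|BC) = -H_min(A|K)`, and
similarly for the other terms. One direction is Cauchy–Schwarz, the other is semidefinite duality by
Hahn–Banach separation. -/

theorem mul_mul_conjTranspose_mono {A B : Matrix n n ℂ} (h : A ≤ B) (C : Matrix m n ℂ) :
    C * A * Cᴴ ≤ C * B * Cᴴ := by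
  rw [Matrix.le_iff] at h ⊢
  simpa [Matrix.mul_sub, Matrix.sub_mul] using h.mul_mul_conjTranspose_same C

theorem conjTranspose_mul_mul_mono {A B : Matrix n n ℂ} (h : A ≤ B) (C : Matrix n m ℂ) :
    Cᴴ * A * C ≤ Cᴴ * B * C := by
  simpa using mul_mul_conjTranspose_mono h Cᴴ

theorem re_trace_nonneg {A : Matrix n n ℂ} (h : A.PosSemidef) : 0 ≤ A.trace.re :=
  (Complex.nonneg_iff.1 h.trace_nonneg).1

theorem re_trace_mono {A B : Matrix n n ℂ} (h : A ≤ B) : A.trace.re ≤ B.trace.re := by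
  have := re_trace_nonneg (Matrix.le_iff.1 h)
  simpa [Matrix.trace_sub] using this

theorem smul_mono_of_nonneg {A B : Matrix n n ℂ} {c : ℝ} (hc : 0 ≤ c) (h : A ≤ B) :
    c • A ≤ c • B := by
  rw [Matrix.le_iff] at h ⊢
  rw [← smul_sub]
  exact h.smul hc

theorem sqrt_mul_sqrt [DecidableEq n] {A : Matrix n n ℂ} (h : A.PosSemidef) :
    CFC.sqrt A * CFC.sqrt A = A :=
  CFC.sqrt_mul_sqrt_self A (Matrix.nonneg_iff_posSemidef.2 h)

theorem sqrt_posSemidef [DecidableEq n] (A : Matrix n n ℂ) : (CFC.sqrt A).PosSemidef :=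
  Matrix.nonneg_iff_posSemidef.1 (CFC.sqrt_nonneg A)

theorem conjTranspose_sqrt [DecidableEq n] (A : Matrix n n ℂ) : (CFC.sqrt A)ᴴ = CFC.sqrt A :=
  (sqrt_posSemidef A).1

theorem sqrt_mul_conjTranspose_sqrt [DecidableEq n] {A : Matrix n n ℂ} (h : A.PosSemidef) :
    CFC.sqrt A * (CFC.sqrt A)ᴴ = A := by
  rw [conjTranspose_sqrt, sqrt_mul_sqrt h]

end Order

/-! ### Hilbert–Schmidt inner product and Cauchy–Schwarz -/

section Overlap

variable {n m k l : Type*} [Fintype n] [Fintype m] [Fintype k] [Fintype l]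

/-- The real part of the Hilbert–Schmidt inner product. -/
noncomputable def overlap (X Y : Matrix n k ℂ) : ℝ := (Xᴴ * Y).trace.re

theorem overlap_eq_sum (X Y : Matrix n k ℂ) :
    overlap X Y = ∑ p : n × k, (star (X p.1 p.2) * Y p.1 p.2).re := by
  rw [overlap, Matrix.trace, Fintype.sum_prod_type_right, Complex.re_sum]
  refine Finset.sum_congr rfl fun j _ => ?_
  simp [Matrix.mul_apply]

theorem overlap_comm (X Y : Matrix n k ℂ) : overlap X Y = overlap Y X := by
  simp only [overlap_eq_sum]
  refine Finset.sum_congr rfl fun p _ => ?_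
  simp [mul_comm]

theorem overlap_self_nonneg (X : Matrix n k ℂ) : 0 ≤ overlap X X :=
  re_trace_nonneg (Matrix.posSemidef_conjTranspose_mul_self X)

theorem overlap_self_eq (X : Matrix n k ℂ) : overlap X X = (X * Xᴴ).trace.re := by
  rw [overlap, Matrix.trace_mul_comm]

theorem overlap_sub_left (X Y Z : Matrix n k ℂ) :
    overlap (X - Y) Z = overlap X Z - overlap Y Z := by
  simp [overlap, Matrix.sub_mul, Matrix.trace_sub]

theorem overlap_smul_left (c : ℝ) (X Z : Matrix n k ℂ) :
    overlap (c • X) Z = c * overlap X Z := by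
  simp [overlap, Matrix.trace_smul]

theorem overlap_sub_right (X Y Z : Matrix n k ℂ) :
    overlap X (Y - Z) = overlap X Y - overlap X Z := by
  simp [overlap, Matrix.mul_sub, Matrix.trace_sub]

theorem overlap_smul_right (c : ℝ) (X Z : Matrix n k ℂ) :
    overlap X (c • Z) = c * overlap X Z := by
  simp [overlap, Matrix.trace_smul]

theorem overlap_mul_left (X : Matrix n k ℂ) (Y : Matrix n m ℂ) (Z : Matrix m k ℂ) :
    overlap X (Y * Z) = overlap (Yᴴ * X) Z := by
  simp [overlap, Matrix.mul_assoc]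

theorem overlap_mul_right (X : Matrix n k ℂ) (Y : Matrix n m ℂ) (Z : Matrix m k ℂ) :
    overlap X (Y * Z) = overlap (X * Zᴴ) Y := by
  rw [overlap, overlap, ← Matrix.mul_assoc, Matrix.trace_mul_comm, ← Matrix.mul_assoc]
  simp

/-- The Cauchy–Schwarz inequality for Hilbert–Schmidt vectors with one additional real
coordinate. -/
theorem overlap_add_mul_le (X Y : Matrix n k ℂ) (α β : ℝ) :
    overlap X Y + α * β ≤
      Real.sqrt (overlap X X + α ^ 2) * Real.sqrt (overlap Y Y + β ^ 2) := by
  have key : ∀ t : ℝ, 0 ≤ (overlap Y Y + β ^ 2) * (t * t)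
      + (-2 * (overlap X Y + α * β)) * t + (overlap X X + α ^ 2) := by
    intro t
    have h1 := overlap_self_nonneg (X - t • Y)
    rw [overlap_sub_left, overlap_sub_right, overlap_sub_right, overlap_smul_left,
      overlap_smul_left, overlap_smul_right, overlap_smul_right, overlap_comm Y X] at h1
    nlinarith [sq_nonneg (α - t * β)]
  have h := discrim_le_zero key
  rw [discrim] at h
  rw [← Real.sqrt_mul (by have := overlap_self_nonneg X; positivity)]
  apply Real.le_sqrt_of_sq_le
  nlinarith

theorem overlap_le_sqrt (X Y : Matrix n k ℂ) :
    overlap X Y ≤ Real.sqrt (overlap X X) * Real.sqrt (overlap Y Y) := by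
  simpa using overlap_add_mul_le X Y 0 0

end Overlap

/-! ### Contractions and Douglas factorization -/

section Contraction

variable {n m k l : Type*} [Fintype n] [Fintype m] [Fintype k] [Fintype l]
  [DecidableEq n] [DecidableEq m] [DecidableEq k] [DecidableEq l]

/-- A rectangular matrix of operator norm at most one. -/
def IsContraction (W : Matrix l k ℂ) : Prop := Wᴴ * W ≤ 1

/-- Hypothesis and conclusion are the two Schur complement criteria for positivity of the block
matrix with rows `(S, X)` and `(Xᴴ, 1)`. -/
theorem conjTranspose_mul_inv_mul_le_one {S : Matrix n n ℂ} (hS : S.PosDef) {X : Matrix n k ℂ}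
    (h : X * Xᴴ ≤ S) : Xᴴ * S⁻¹ * X ≤ 1 := by
  have := hS.isUnit.invertible
  rw [Matrix.le_iff, ← Matrix.PosDef.fromBlocks₁₁ X 1 hS]
  rw [Matrix.le_iff] at h
  have h1 : (1 : Matrix k k ℂ).PosDef := Matrix.PosDef.one
  have : Invertible (1 : Matrix k k ℂ) := invertibleOne
  rw [Matrix.PosDef.fromBlocks₂₂ S X h1]
  simpa using h

theorem IsContraction.conjTranspose {W : Matrix l k ℂ} (h : IsContraction W) :
    IsContraction Wᴴ := by
  have := conjTranspose_mul_inv_mul_le_one (X := Wᴴ) Matrix.PosDef.one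
    (by simpa [IsContraction] using h)
  simpa [IsContraction] using this

theorem IsContraction.mul {V : Matrix l k ℂ} {W : Matrix k m ℂ} (hV : IsContraction V)
    (hW : IsContraction W) : IsContraction (V * W) := by
  have := conjTranspose_mul_mul_mono hV W
  refine le_trans ?_ (le_trans this (by simpa [IsContraction] using hW))
  simp [Matrix.mul_assoc]

theorem IsContraction.mul_conjTranspose_le {W : Matrix l k ℂ} (h : IsContraction W)
    (X : Matrix n l ℂ) : X * W * (X * W)ᴴ ≤ X * Xᴴ := by
  have := mul_mul_conjTranspose_mono h.conjTranspose X
  simpa [Matrix.mul_assoc] using this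

theorem IsContraction.overlap_self_le {W : Matrix l k ℂ} (h : IsContraction W)
    (X : Matrix n l ℂ) : overlap (X * W) (X * W) ≤ overlap X X := by
  rw [overlap_self_eq, overlap_self_eq]
  exact re_trace_mono (h.mul_conjTranspose_le X)

theorem norm_sq_toEuclideanLin (X : Matrix k n ℂ) (u : EuclideanSpace ℂ n) :
    ‖Matrix.toEuclideanLin X u‖ ^ 2 = (star u.ofLp ⬝ᵥ ((Xᴴ * X) *ᵥ u.ofLp)).re := by
  rw [← Matrix.mulVec_mulVec, Matrix.dotProduct_mulVec, Matrix.vecMul_conjTranspose, star_star,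
    EuclideanSpace.norm_sq_eq, dotProduct, Complex.re_sum]
  refine Finset.sum_congr rfl fun i _ => ?_
  simp only [Matrix.toLpLin_apply, Pi.star_apply, RCLike.star_def]
  rw [← Complex.normSq_eq_norm_sq, ← Complex.normSq_eq_conj_mul_self]
  simp

/-- Douglas' factorization lemma for matrices. -/
theorem exists_contraction_of_le {X : Matrix n k ℂ} {Y : Matrix n l ℂ}
    (h : X * Xᴴ ≤ Y * Yᴴ) : ∃ V : Matrix l k ℂ, IsContraction V ∧ X = Y * V := by
  set f := Matrix.toEuclideanLin Xᴴ with hf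
  set g := Matrix.toEuclideanLin Yᴴ with hg
  have hfg : ∀ u, ‖f u‖ ≤ ‖g u‖ := by
    intro u
    refine le_of_sq_le_sq ?_ (norm_nonneg _)
    rw [hf, hg, norm_sq_toEuclideanLin, norm_sq_toEuclideanLin]
    have := (Matrix.le_iff.1 h).dotProduct_mulVec_nonneg u.ofLp
    have := (Complex.nonneg_iff.1 this).1
    simp only [Matrix.sub_mulVec, dotProduct_sub, Complex.sub_re] at this
    simpa using this
  obtain ⟨s, hs⟩ := g.rangeRestrict.exists_rightInverse_of_surjective g.range_rangeRestrict
  have hs' : ∀ y : g.range, g (s y) = y := fun y => by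
    have := LinearMap.congr_fun hs y
    exact congrArg Subtype.val this
  set P := g.range.orthogonalProjectionOnto with hP
  -- The norm bound gives `ker g ⊆ ker f`, so `g u ↦ f u` is well defined on the range of `g`; `T`
  -- extends it by zero to the orthogonal complement.
  set T : EuclideanSpace ℂ l →ₗ[ℂ] EuclideanSpace ℂ k := f ∘ₗ s ∘ₗ P.toLinearMap with hT
  have hTn : ∀ v, ‖T v‖ ≤ ‖v‖ := by
    intro v
    calc ‖T v‖ ≤ ‖g (s (P v))‖ := hfg _
      _ = ‖P v‖ := by rw [hs']; rfl
      _ ≤ ‖v‖ := Submodule.norm_orthogonalProjectionOnto_apply_le _ _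
  have hTg : ∀ u, T (g u) = f u := by
    intro u
    have h1 : P (g u) = ⟨g u, LinearMap.mem_range_self g u⟩ :=
      Submodule.orthogonalProjectionOnto_mem_subspace_eq_self (K := g.range) ⟨g u, _⟩
    have h2 : ‖f (s (P (g u)) - u)‖ ≤ 0 := by
      refine (hfg _).trans ?_
      rw [map_sub, hs', h1]
      simp
    have h3 := norm_le_zero_iff.1 h2
    rw [map_sub, sub_eq_zero] at h3
    exact h3
  set M : Matrix k l ℂ := Matrix.toEuclideanLin.symm T with hM
  have hMT : Matrix.toEuclideanLin M = T := by simp [hM]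
  have hMc : IsContraction M := by
    rw [IsContraction, Matrix.le_iff]
    refine Matrix.PosSemidef.of_dotProduct_mulVec_nonneg ?_ fun v => ?_
    · simp [Matrix.IsHermitian]
    · have hh : ((1 : Matrix l l ℂ) - Mᴴ * M).IsHermitian := by simp [Matrix.IsHermitian]
      have h1 := norm_sq_toEuclideanLin M (WithLp.toLp 2 v)
      rw [hMT] at h1
      have h3 := hTn (WithLp.toLp 2 v)
      have h4 := pow_le_pow_left₀ (norm_nonneg _) h3 2
      rw [Complex.nonneg_iff]
      refine ⟨?_, ?_⟩
      · simp only [Matrix.sub_mulVec, dotProduct_sub, Complex.sub_re]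
        rw [h1] at h4
        simp only [Matrix.one_mulVec]
        rw [EuclideanSpace.norm_sq_eq] at h4
        have h5 : (star v ⬝ᵥ v).re = ∑ i, ‖v i‖ ^ 2 := by
          rw [dotProduct, Complex.re_sum]
          refine Finset.sum_congr rfl fun i _ => ?_
          simp only [Pi.star_apply, RCLike.star_def]
          rw [← Complex.normSq_eq_norm_sq, ← Complex.normSq_eq_conj_mul_self]
          simp
        rw [h5]
        simpa using h4
      · exact (hh.im_star_dotProduct_mulVec_self v).symm
  refine ⟨Mᴴ, hMc.conjTranspose, ?_⟩
  have : M * Yᴴ = Xᴴ := by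
    apply Matrix.toEuclideanLin.injective
    ext1 u
    rw [← hf, ← hTg, ← hMT, hg]
    simp [Matrix.toLpLin_apply]
  have := congrArg Matrix.conjTranspose this
  simpa using this.symm

end Contraction

/-! ### Trace norm, fidelity and Uhlmann's theorem -/

section Uhlmann

variable {n m k l : Type*} [Fintype n] [Fintype m] [Fintype k] [Fintype l]
  [DecidableEq n] [DecidableEq m] [DecidableEq k] [DecidableEq l]

theorem re_trace_mul_contraction_le {N U : Matrix n n ℂ} (hN : N.PosSemidef)
    (hU : IsContraction U) : (N * U).trace.re ≤ N.trace.re := by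
  set R := CFC.sqrt N with hR
  have h1 : (N * U).trace.re = overlap R (R * U) := by
    rw [overlap, ← Matrix.mul_assoc, conjTranspose_sqrt, sqrt_mul_sqrt hN]
  have h2 : N.trace.re = overlap R R := by
    rw [overlap, conjTranspose_sqrt, sqrt_mul_sqrt hN]
  rw [h1, h2]
  refine (overlap_le_sqrt _ _).trans ?_
  calc _ ≤ Real.sqrt (overlap R R) * Real.sqrt (overlap R R) := by
        gcongr
        exact hU.overlap_self_le R
    _ = _ := Real.mul_self_sqrt (overlap_self_nonneg R)

theorem traceNorm_nonneg (M : Matrix n n ℂ) : 0 ≤ traceNorm M :=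
  re_trace_nonneg (sqrt_posSemidef _)

/-- Douglas factorization replaces the polar decomposition: `Mᴴ` and `|M|` have the same `Y * Yᴴ`,
so each is the other times a contraction. One factorization gives this bound, the other its
attainment. -/
theorem re_trace_mul_le_traceNorm (M : Matrix n n ℂ) {W : Matrix n n ℂ} (hW : IsContraction W) :
    (M * W).trace.re ≤ traceNorm M := by
  have hs := sqrt_mul_conjTranspose_sqrt (Matrix.posSemidef_conjTranspose_mul_self M)
  obtain ⟨V, hV, h⟩ := exists_contraction_of_le (X := Mᴴ) (Y := CFC.sqrt (Mᴴ * M))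
    (by rw [hs]; simp)
  have hM : M = Vᴴ * CFC.sqrt (Mᴴ * M) := by
    have := congrArg Matrix.conjTranspose h
    simpa only [Matrix.conjTranspose_conjTranspose, Matrix.conjTranspose_mul,
      conjTranspose_sqrt] using this
  calc (M * W).trace.re = (Vᴴ * (CFC.sqrt (Mᴴ * M) * W)).trace.re := by
        rw [← Matrix.mul_assoc, ← hM]
    _ = (CFC.sqrt (Mᴴ * M) * (W * Vᴴ)).trace.re := by
        rw [Matrix.trace_mul_comm, Matrix.mul_assoc]
    _ ≤ _ := re_trace_mul_contraction_le (sqrt_posSemidef _) (hW.mul hV.conjTranspose)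

theorem exists_re_trace_mul_eq_traceNorm (M : Matrix n n ℂ) :
    ∃ W : Matrix n n ℂ, IsContraction W ∧ (M * W).trace.re = traceNorm M := by
  have hs := sqrt_mul_conjTranspose_sqrt (Matrix.posSemidef_conjTranspose_mul_self M)
  obtain ⟨V, hV, h⟩ := exists_contraction_of_le (Y := Mᴴ) (X := CFC.sqrt (Mᴴ * M))
    (by rw [hs]; simp)
  refine ⟨Vᴴ, hV.conjTranspose, ?_⟩
  rw [traceNorm, h, Matrix.trace_mul_comm, ← Complex.conj_re, ← RCLike.star_def,
    ← Matrix.trace_conjTranspose]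
  simp

theorem fidelity_nonneg (ρ σ : Matrix n n ℂ) : 0 ≤ fidelity ρ σ := traceNorm_nonneg _

/-- Every pair of amplitudes of two states bounds their fidelity from below. -/
theorem overlap_mul_le_fidelity (X : Matrix n k ℂ) (Y : Matrix n l ℂ) {W : Matrix l k ℂ}
    (hW : IsContraction W) : overlap X (Y * W) ≤ fidelity (X * Xᴴ) (Y * Yᴴ) := by
  have hX := sqrt_mul_conjTranspose_sqrt (Matrix.posSemidef_self_mul_conjTranspose X)
  have hY := sqrt_mul_conjTranspose_sqrt (Matrix.posSemidef_self_mul_conjTranspose Y)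
  obtain ⟨V, hV, h⟩ := exists_contraction_of_le hX.ge
  obtain ⟨U, hU, h'⟩ := exists_contraction_of_le hY.ge
  refine le_trans (le_of_eq ?_) (re_trace_mul_le_traceNorm _ ((hU.mul hW).mul hV.conjTranspose))
  rw [overlap]
  conv_lhs => rw [h, h']
  rw [Matrix.conjTranspose_mul, conjTranspose_sqrt, Matrix.mul_assoc, Matrix.trace_mul_comm]
  simp only [Matrix.mul_assoc]

/-- Uhlmann's theorem for arbitrary amplitudes. -/
theorem exists_overlap_mul_eq_fidelity (X : Matrix n k ℂ) (Y : Matrix n l ℂ) :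
    ∃ W : Matrix l k ℂ, IsContraction W ∧
      overlap X (Y * W) = fidelity (X * Xᴴ) (Y * Yᴴ) := by
  have hX := sqrt_mul_conjTranspose_sqrt (Matrix.posSemidef_self_mul_conjTranspose X)
  have hY := sqrt_mul_conjTranspose_sqrt (Matrix.posSemidef_self_mul_conjTranspose Y)
  obtain ⟨V, hV, h⟩ := exists_contraction_of_le hX.le
  obtain ⟨U, hU, h'⟩ := exists_contraction_of_le hY.le
  obtain ⟨W, hW, hF⟩ := exists_re_trace_mul_eq_traceNorm
    (CFC.sqrt (X * Xᴴ) * CFC.sqrt (Y * Yᴴ))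
  refine ⟨U * W * Vᴴ, (hU.mul hW).mul hV.conjTranspose, ?_⟩
  rw [fidelity, ← hF]
  conv_rhs => rw [← conjTranspose_sqrt (X * Xᴴ), h, h']
  rw [overlap, Matrix.conjTranspose_mul]
  simp only [Matrix.mul_assoc]
  rw [Matrix.trace_mul_comm Vᴴ]
  simp only [Matrix.mul_assoc]

theorem overlap_le_fidelity (X Y : Matrix n k ℂ) :
    overlap X Y ≤ fidelity (X * Xᴴ) (Y * Yᴴ) := by
  have h : IsContraction (1 : Matrix k k ℂ) := by simp [IsContraction]
  simpa using overlap_mul_le_fidelity X Y h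

/-- Since `√σ = √τ V` with `V` a contraction, an Uhlmann contraction `W` for `σ` gives the
competitor `V * W` for `τ`. -/
theorem fidelity_mono_right {ρ σ τ : Matrix n n ℂ} (hρ : ρ.PosSemidef) (hσ : σ.PosSemidef)
    (hτ : τ.PosSemidef) (h : σ ≤ τ) : fidelity ρ σ ≤ fidelity ρ τ := by
  rw [← sqrt_mul_conjTranspose_sqrt hρ, ← sqrt_mul_conjTranspose_sqrt hτ]
  rw [← sqrt_mul_conjTranspose_sqrt hσ, ← sqrt_mul_conjTranspose_sqrt hτ] at h
  rw [← sqrt_mul_conjTranspose_sqrt hσ]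
  obtain ⟨V, hV, h'⟩ := exists_contraction_of_le h
  obtain ⟨W, hW, h''⟩ := exists_overlap_mul_eq_fidelity (CFC.sqrt ρ) (CFC.sqrt σ)
  rw [← h'', h', Matrix.mul_assoc]
  exact overlap_mul_le_fidelity _ _ (hV.mul hW)

theorem fidelity_le_comm {ρ σ : Matrix n n ℂ} (hρ : ρ.PosSemidef) (hσ : σ.PosSemidef) :
    fidelity ρ σ ≤ fidelity σ ρ := by
  rw [← sqrt_mul_conjTranspose_sqrt hρ, ← sqrt_mul_conjTranspose_sqrt hσ]
  obtain ⟨W, hW, h⟩ := exists_overlap_mul_eq_fidelity (CFC.sqrt ρ) (CFC.sqrt σ)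
  rw [← h, overlap_mul_right, overlap_comm]
  exact overlap_mul_le_fidelity _ _ hW.conjTranspose

theorem fidelity_comm {ρ σ : Matrix n n ℂ} (hρ : ρ.PosSemidef) (hσ : σ.PosSemidef) :
    fidelity ρ σ = fidelity σ ρ :=
  le_antisymm (fidelity_le_comm hρ hσ) (fidelity_le_comm hσ hρ)

theorem fidelity_sq_le {ρ σ : Matrix n n ℂ} (hρ : ρ.PosSemidef) (hσ : σ.PosSemidef) :
    fidelity ρ σ ^ 2 ≤ ρ.trace.re * σ.trace.re := by
  obtain ⟨W, hW, h⟩ := exists_overlap_mul_eq_fidelity (CFC.sqrt ρ) (CFC.sqrt σ)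
  rw [sqrt_mul_conjTranspose_sqrt hρ, sqrt_mul_conjTranspose_sqrt hσ] at h
  have h1 := overlap_le_sqrt (CFC.sqrt ρ) (CFC.sqrt σ * W)
  have h2 := hW.overlap_self_le (CFC.sqrt σ)
  have e1 : overlap (CFC.sqrt ρ) (CFC.sqrt ρ) = ρ.trace.re := by
    rw [overlap_self_eq, sqrt_mul_conjTranspose_sqrt hρ]
  have e2 : overlap (CFC.sqrt σ) (CFC.sqrt σ) = σ.trace.re := by
    rw [overlap_self_eq, sqrt_mul_conjTranspose_sqrt hσ]
  rw [h, e1] at h1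
  rw [e2] at h2
  calc fidelity ρ σ ^ 2 ≤ (Real.sqrt ρ.trace.re * Real.sqrt σ.trace.re) ^ 2 := by
        refine pow_le_pow_left₀ (fidelity_nonneg _ _) (h1.trans ?_) 2
        gcongr
    _ = _ := by
        rw [mul_pow, Real.sq_sqrt (re_trace_nonneg hρ), Real.sq_sqrt (re_trace_nonneg hσ)]

end Uhlmann

/-! ### Rearranging amplitudes and partial traces -/

section Reshape

variable {n k n' k' : Type*} [Fintype n] [Fintype k] [Fintype n'] [Fintype k']

/-- The rearrangement of the entries of a matrix along a bijection of its index pairs. -/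
def reshape (e : n × k ≃ n' × k') (X : Matrix n k ℂ) : Matrix n' k' ℂ :=
  Matrix.of fun i j => X (e.symm (i, j)).1 (e.symm (i, j)).2

theorem overlap_reshape (e : n × k ≃ n' × k') (X Y : Matrix n k ℂ) :
    overlap (reshape e X) (reshape e Y) = overlap X Y := by
  rw [overlap_eq_sum, overlap_eq_sum]
  exact Equiv.sum_comp e.symm fun p : n × k => (star (X p.1 p.2) * Y p.1 p.2).re

theorem reshape_symm_reshape (e : n × k ≃ n' × k') (X : Matrix n' k' ℂ) :
    reshape e (reshape e.symm X) = X := by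
  ext i j
  simp [reshape]

/-- Moving the first tensor factor of the row space to the column space. -/
def slideEquiv (a n k : Type*) : (a × n) × k ≃ n × (a × k) where
  toFun p := (p.1.2, (p.1.1, p.2))
  invFun p := ((p.2.1, p.1), p.2.2)
  left_inv _ := rfl
  right_inv _ := rfl

/-- Counting `a` as part of the purifying system turns an amplitude of a state into one of its
marginal. -/
theorem slide_mul_conjTranspose {a : Type*} [Fintype a] (X : Matrix (a × n) k ℂ) :
    reshape (slideEquiv a n k) X * (reshape (slideEquiv a n k) X)ᴴ = traceFirst (X * Xᴴ) := by
  ext i j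
  simp [reshape, slideEquiv, traceFirst, Matrix.mul_apply, Fintype.sum_prod_type]

theorem trace_traceFirst {a : Type*} [Fintype a] (ρ : Matrix (a × n) (a × n) ℂ) :
    (traceFirst ρ).trace = ρ.trace := by
  simp [traceFirst, Matrix.trace, Fintype.sum_prod_type_right]

theorem traceFirst_posSemidef {a : Type*} [Fintype a] {ρ : Matrix (a × n) (a × n) ℂ}
    (h : ρ.PosSemidef) : (traceFirst ρ).PosSemidef := by
  classical
  rw [← sqrt_mul_conjTranspose_sqrt h, ← slide_mul_conjTranspose]
  exact Matrix.posSemidef_self_mul_conjTranspose _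

theorem IsSubnormalized.traceFirst {a : Type*} [Fintype a] {ρ : Matrix (a × n) (a × n) ℂ}
    (h : IsSubnormalized ρ) : IsSubnormalized (traceFirst ρ) :=
  ⟨traceFirst_posSemidef h.1, by rw [trace_traceFirst]; exact h.2⟩

end Reshape

/-! ### Generalized fidelity and purified distance -/

section PurifiedDistance

variable {n k l : Type*} [Fintype n] [Fintype k] [Fintype l]
  [DecidableEq n] [DecidableEq k] [DecidableEq l]

/-- The generalized fidelity of two amplitudes. -/
noncomputable def ampFidelity (X Y : Matrix n k ℂ) : ℝ :=
  overlap X Y + Real.sqrt ((1 - overlap X X) * (1 - overlap Y Y))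

theorem ampFidelity_comm (X Y : Matrix n k ℂ) : ampFidelity X Y = ampFidelity Y X := by
  rw [ampFidelity, ampFidelity, overlap_comm, mul_comm]

theorem ampFidelity_reshape {n' k' : Type*} [Fintype n'] [Fintype k'] (e : n × k ≃ n' × k')
    (X Y : Matrix n k ℂ) : ampFidelity (reshape e X) (reshape e Y) = ampFidelity X Y := by
  simp only [ampFidelity, overlap_reshape]

theorem ampFidelity_le_genFidelity (X Y : Matrix n k ℂ) :
    ampFidelity X Y ≤ genFidelity (X * Xᴴ) (Y * Yᴴ) := by
  rw [ampFidelity, genFidelity, overlap_self_eq, overlap_self_eq]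
  gcongr
  exact overlap_le_fidelity X Y

theorem ampFidelity_le_one {X Y : Matrix n k ℂ} (hX : overlap X X ≤ 1) (hY : overlap Y Y ≤ 1) :
    ampFidelity X Y ≤ 1 := by
  have h := overlap_add_mul_le X Y (Real.sqrt (1 - overlap X X)) (Real.sqrt (1 - overlap Y Y))
  rw [Real.sq_sqrt (by linarith), Real.sq_sqrt (by linarith)] at h
  rw [ampFidelity, Real.sqrt_mul (by linarith)]
  simpa using h

/-- With the extra coordinate `√(1 - overlap X X)` amplitudes become unit vectors and `ampFidelity`
their inner product. The claim is Cauchy–Schwarz for the parts of `X` and `Z` orthogonal to `Y`: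
angles between unit vectors add at most. -/
theorem ampFidelity_triangle {X Y Z : Matrix n k ℂ} (hX : overlap X X ≤ 1)
    (hY : overlap Y Y ≤ 1) (hZ : overlap Z Z ≤ 1) :
    ampFidelity X Y * ampFidelity Y Z
        - Real.sqrt (1 - ampFidelity X Y ^ 2) * Real.sqrt (1 - ampFidelity Y Z ^ 2)
      ≤ ampFidelity X Z := by
  set a := ampFidelity X Y with ha
  set b := ampFidelity Y Z with hb
  set x := Real.sqrt (1 - overlap X X) with hx
  set y := Real.sqrt (1 - overlap Y Y) with hy
  set z := Real.sqrt (1 - overlap Z Z) with hz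
  have hx2 : x ^ 2 = 1 - overlap X X := Real.sq_sqrt (by linarith)
  have hy2 : y ^ 2 = 1 - overlap Y Y := Real.sq_sqrt (by linarith)
  have hz2 : z ^ 2 = 1 - overlap Z Z := Real.sq_sqrt (by linarith)
  have ha' : a = overlap X Y + x * y := by
    rw [ha, ampFidelity, Real.sqrt_mul (by linarith)]
  have hb' : b = overlap Y Z + y * z := by
    rw [hb, ampFidelity, Real.sqrt_mul (by linarith)]
  have hc : ampFidelity X Z = overlap X Z + x * z := by
    rw [ampFidelity, Real.sqrt_mul (by linarith)]
  have h := overlap_add_mul_le (a • Y - X) (Z - b • Y) (a * y - x) (z - b * y)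
  simp only [overlap_sub_left, overlap_sub_right, overlap_smul_left, overlap_smul_right,
    overlap_comm Y X, overlap_comm Z Y] at h
  have e1 : a * (a * overlap Y Y) - a * overlap X Y - (a * overlap X Y - overlap X X)
      + (a * y - x) ^ 2 = 1 - a ^ 2 := by
    linear_combination a ^ 2 * hy2 + hx2 + 2 * a * ha'
  have e2 : overlap Z Z - b * overlap Y Z - (b * overlap Y Z - b * (b * overlap Y Y))
      + (z - b * y) ^ 2 = 1 - b ^ 2 := by
    linear_combination b ^ 2 * hy2 + hz2 + 2 * b * hb'
  have e3 : a * overlap Y Z - overlap X Z - (a * (b * overlap Y Y) - b * overlap X Y)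
      + (a * y - x) * (z - b * y) = a * b - (overlap X Z + x * z) := by
    linear_combination -a * b * hy2 - a * hb' - b * ha'
  rw [hc]
  have h' : a * b - (overlap X Z + x * z)
      ≤ Real.sqrt (1 - a ^ 2) * Real.sqrt (1 - b ^ 2) := by
    rw [← e1, ← e2, ← e3]
    convert h using 3 <;> ring
  linarith

theorem overlap_fromCols (X Y : Matrix n k ℂ) (X' Y' : Matrix n l ℂ) :
    overlap (Matrix.fromCols X X') (Matrix.fromCols Y Y') = overlap X Y + overlap X' Y' := by
  simp only [overlap_eq_sum, Fintype.sum_prod_type, Fintype.sum_sum_type, Finset.sum_add_distrib]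
  simp

theorem fromCols_mul_conjTranspose (X : Matrix n k ℂ) (X' : Matrix n l ℂ) :
    Matrix.fromCols X X' * (Matrix.fromCols X X')ᴴ = X * Xᴴ + X' * X'ᴴ := by
  rw [Matrix.conjTranspose_fromCols_eq_fromRows_conjTranspose, Matrix.fromCols_mul_fromRows]

/-- Uhlmann's theorem: an amplitude of `σ` that realizes the generalized fidelity with a given
amplitude, after enlarging the purifying system. -/
theorem exists_amplitude_eq (X : Matrix n k ℂ) {σ : Matrix n n ℂ} (hσ : σ.PosSemidef) :
    ∃ Y : Matrix n (k ⊕ n) ℂ, Y * Yᴴ = σ ∧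
      ampFidelity (Matrix.fromCols X 0) Y = genFidelity (X * Xᴴ) σ := by
  obtain ⟨S, hSS⟩ : ∃ S : Matrix n n ℂ, S * Sᴴ = σ := ⟨_, sqrt_mul_conjTranspose_sqrt hσ⟩
  obtain ⟨W, hW, hF⟩ := exists_overlap_mul_eq_fidelity X S
  have hT : (1 - W * Wᴴ).PosSemidef := by
    have := Matrix.le_iff.1 hW.conjTranspose
    simpa using this
  -- The second block restores the mass lost to the contraction `W` and is invisible to the overlap
  -- with `(X, 0)`.
  have hY : Matrix.fromCols (S * W) (S * CFC.sqrt (1 - W * Wᴴ)) *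
      (Matrix.fromCols (S * W) (S * CFC.sqrt (1 - W * Wᴴ)))ᴴ = σ := by
    have h2 := sqrt_mul_conjTranspose_sqrt hT
    rw [fromCols_mul_conjTranspose, Matrix.conjTranspose_mul, Matrix.conjTranspose_mul,
      Matrix.mul_assoc S, Matrix.mul_assoc S, ← Matrix.mul_assoc W,
      ← Matrix.mul_assoc (CFC.sqrt _), h2, ← Matrix.mul_add, ← Matrix.add_mul]
    simpa using hSS
  refine ⟨_, hY, ?_⟩
  rw [ampFidelity, genFidelity, overlap_self_eq (Matrix.fromCols (S * W) _), hY, overlap_fromCols,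
    overlap_fromCols, hF, hSS, overlap_self_eq X]
  simp [overlap]

/-- Uhlmann's theorem with a fixed purifying system, which may force a loss of mass. -/
theorem exists_amplitude_le (X : Matrix n k ℂ) (hX : overlap X X ≤ 1) {σ : Matrix n n ℂ}
    (hσ : σ.PosSemidef) :
    ∃ Y : Matrix n k ℂ, Y * Yᴴ ≤ σ ∧ genFidelity (X * Xᴴ) σ ≤ ampFidelity X Y := by
  have hSS := sqrt_mul_conjTranspose_sqrt hσ
  obtain ⟨W, hW, hF⟩ := exists_overlap_mul_eq_fidelity X (CFC.sqrt σ)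
  have h := hW.mul_conjTranspose_le (CFC.sqrt σ)
  rw [hSS] at h
  refine ⟨_, h, ?_⟩
  rw [ampFidelity, genFidelity, hF, hSS, overlap_self_eq X, overlap_self_eq (_ * _)]
  rw [overlap_self_eq] at hX
  -- Losing mass can only enlarge the square-root term of the generalized fidelity.
  have := re_trace_mono h
  gcongr

theorem genFidelity_nonneg (ρ σ : Matrix n n ℂ) : 0 ≤ genFidelity ρ σ :=
  add_nonneg (fidelity_nonneg _ _) (Real.sqrt_nonneg _)

theorem genFidelity_comm {ρ σ : Matrix n n ℂ} (hρ : ρ.PosSemidef) (hσ : σ.PosSemidef) :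
    genFidelity ρ σ = genFidelity σ ρ := by
  rw [genFidelity, genFidelity, fidelity_comm hρ hσ, mul_comm]

theorem purifiedDist_comm {ρ σ : Matrix n n ℂ} (hρ : ρ.PosSemidef) (hσ : σ.PosSemidef) :
    purifiedDist ρ σ = purifiedDist σ ρ := by
  rw [purifiedDist, purifiedDist, genFidelity_comm hρ hσ]

theorem overlap_self_le_one {X : Matrix n k ℂ} {ρ : Matrix n n ℂ} (hρ : IsSubnormalized ρ)
    (h : X * Xᴴ ≤ ρ) : overlap X X ≤ 1 := by
  rw [overlap_self_eq]
  exact (re_trace_mono h).trans hρ.2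

theorem isSubnormalized_mul_conjTranspose {X : Matrix n k ℂ} (h : overlap X X ≤ 1) :
    IsSubnormalized (X * Xᴴ) :=
  ⟨Matrix.posSemidef_self_mul_conjTranspose X, by rwa [overlap_self_eq] at h⟩

theorem genFidelity_le_one {ρ σ : Matrix n n ℂ} (hρ : IsSubnormalized ρ)
    (hσ : IsSubnormalized σ) : genFidelity ρ σ ≤ 1 := by
  have hX := sqrt_mul_conjTranspose_sqrt hρ.1
  obtain ⟨Y, hY, h⟩ := exists_amplitude_le (CFC.sqrt ρ) (overlap_self_le_one hρ hX.le) hσ.1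
  rw [hX] at h
  exact h.trans (ampFidelity_le_one (overlap_self_le_one hρ hX.le) (overlap_self_le_one hσ hY))

/-- With one amplitude of the middle state `σ` fixed, Uhlmann's theorem realizes both fidelities in
the same purifying system, which reduces the claim to vectors. -/
theorem genFidelity_triangle {ρ σ τ : Matrix n n ℂ} (hρ : IsSubnormalized ρ)
    (hσ : IsSubnormalized σ) (hτ : IsSubnormalized τ) :
    genFidelity ρ σ * genFidelity σ τ - purifiedDist ρ σ * purifiedDist σ τ
      ≤ genFidelity ρ τ := by
  have hS := sqrt_mul_conjTranspose_sqrt hσ.1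
  obtain ⟨X, hX, h1⟩ := exists_amplitude_eq (CFC.sqrt σ) hρ.1
  obtain ⟨Z, hZ, h2⟩ := exists_amplitude_eq (CFC.sqrt σ) hτ.1
  rw [hS] at h1 h2
  have h3 : overlap (Matrix.fromCols (CFC.sqrt σ) (0 : Matrix n n ℂ))
      (Matrix.fromCols (CFC.sqrt σ) 0) ≤ 1 := by
    refine overlap_self_le_one hσ (le_of_eq ?_)
    rw [fromCols_mul_conjTranspose, hS]
    simp
  have h := ampFidelity_triangle (overlap_self_le_one hρ hX.le) h3 (overlap_self_le_one hτ hZ.le)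
  have h4 := ampFidelity_le_genFidelity X Z
  rw [hX, hZ] at h4
  rw [purifiedDist, purifiedDist, genFidelity_comm hρ.1 hσ.1, ← h1, ← h2]
  rw [ampFidelity_comm X] at h
  exact h.trans h4

theorem purifiedDist_triangle {ρ σ τ : Matrix n n ℂ} (hρ : IsSubnormalized ρ)
    (hσ : IsSubnormalized σ) (hτ : IsSubnormalized τ) :
    purifiedDist ρ τ ≤ purifiedDist ρ σ + purifiedDist σ τ := by
  have h := genFidelity_triangle hρ hσ hτ
  have a0 := genFidelity_nonneg ρ σ
  have b0 := genFidelity_nonneg σ τ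
  have a1 := genFidelity_le_one hρ hσ
  have b1 := genFidelity_le_one hσ hτ
  have p0 : 0 ≤ purifiedDist ρ σ := Real.sqrt_nonneg _
  have q0 : 0 ≤ purifiedDist σ τ := Real.sqrt_nonneg _
  have hp : purifiedDist ρ σ ^ 2 = 1 - genFidelity ρ σ ^ 2 := Real.sq_sqrt (by nlinarith)
  have hq : purifiedDist σ τ ^ 2 = 1 - genFidelity σ τ ^ 2 := Real.sq_sqrt (by nlinarith)
  rw [purifiedDist.eq_1 ρ τ]
  refine Real.sqrt_le_iff.2 ⟨by positivity, ?_⟩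
  generalize genFidelity ρ σ = a at *
  generalize genFidelity σ τ = b at *
  generalize purifiedDist ρ σ = p at *
  generalize purifiedDist σ τ = q at *
  generalize genFidelity ρ τ = c at *
  -- Here `a, b` are cosines and `p, q` sines of two angles. If the angles sum to at most `π/2`, the
  -- bound is the sine of the sum, `a q + b p ≤ p + q`; otherwise `p² + q² ≥ 1` and the claim is
  -- trivial.
  by_cases hc : p * q ≤ a * b
  · have h1 : (a * b - p * q) ^ 2 ≤ c ^ 2 := pow_le_pow_left₀ (by linarith) h 2
    have h2 : 1 - (a * b - p * q) ^ 2 = (a * q + b * p) ^ 2 := by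
      linear_combination -(b ^ 2 + q ^ 2) * hp - hq
    have h3 : (a * q + b * p) ^ 2 ≤ (p + q) ^ 2 :=
      pow_le_pow_left₀ (by positivity) (by nlinarith) 2
    linarith
  · have h1 : (a * b) ^ 2 ≤ (p * q) ^ 2 :=
      pow_le_pow_left₀ (by positivity) (by linarith) 2
    have h2 : 1 ≤ p ^ 2 + q ^ 2 := by
      have e : (a * b) ^ 2 = (1 - p ^ 2) * (1 - q ^ 2) := by
        rw [hp, hq]; ring
      nlinarith
    nlinarith [sq_nonneg c, mul_nonneg p0 q0]

theorem purifiedDist_le_of_genFidelity_le {m : Type*} [Fintype m] [DecidableEq m]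
    {ρ σ : Matrix n n ℂ} {ρ' σ' : Matrix m m ℂ} (h : genFidelity ρ σ ≤ genFidelity ρ' σ') :
    purifiedDist ρ' σ' ≤ purifiedDist ρ σ := by
  have := pow_le_pow_left₀ (genFidelity_nonneg ρ σ) h 2
  exact Real.sqrt_le_sqrt (by linarith)

theorem purifiedDist_self {ρ : Matrix n n ℂ} (hρ : IsSubnormalized ρ) :
    purifiedDist ρ ρ = 0 := by
  have hS := sqrt_mul_conjTranspose_sqrt hρ.1
  have h := ampFidelity_le_genFidelity (CFC.sqrt ρ) (CFC.sqrt ρ)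
  have h1 : ampFidelity (CFC.sqrt ρ) (CFC.sqrt ρ) = 1 := by
    have := overlap_self_le_one hρ hS.le
    rw [ampFidelity, Real.sqrt_mul_self (by linarith)]
    ring
  rw [h1, hS] at h
  exact Real.sqrt_eq_zero_of_nonpos (by nlinarith)

theorem genFidelity_le_traceFirst {a : Type*} [Fintype a] [DecidableEq a]
    {ρ σ : Matrix (a × n) (a × n) ℂ} (hρ : ρ.PosSemidef) (hσ : σ.PosSemidef) :
    genFidelity ρ σ ≤ genFidelity (traceFirst ρ) (traceFirst σ) := by
  have hS := sqrt_mul_conjTranspose_sqrt hρ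
  obtain ⟨Y, hY, h⟩ := exists_amplitude_eq (CFC.sqrt ρ) hσ
  rw [hS] at h
  rw [← h, ← ampFidelity_reshape (slideEquiv a n _)]
  refine (ampFidelity_le_genFidelity _ _).trans (le_of_eq ?_)
  rw [slide_mul_conjTranspose, slide_mul_conjTranspose, hY, fromCols_mul_conjTranspose, hS]
  simp

theorem genFidelity_le_submatrix {m : Type*} [Fintype m] [DecidableEq m] (e : m ≃ n)
    {ρ σ : Matrix n n ℂ} (hρ : ρ.PosSemidef) (hσ : σ.PosSemidef) :
    genFidelity ρ σ ≤ genFidelity (ρ.submatrix e e) (σ.submatrix e e) := by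
  have hS := sqrt_mul_conjTranspose_sqrt hρ
  obtain ⟨Y, hY, h⟩ := exists_amplitude_eq (CFC.sqrt ρ) hσ
  rw [hS] at h
  have key : ∀ X : Matrix n (n ⊕ n) ℂ,
      reshape (e.symm.prodCongr (Equiv.refl _)) X * (reshape (e.symm.prodCongr (Equiv.refl _)) X)ᴴ
        = (X * Xᴴ).submatrix e e := by
    intro X
    ext i j
    simp [reshape, Matrix.mul_apply]
  rw [← h, ← ampFidelity_reshape (e.symm.prodCongr (Equiv.refl _))]
  refine (ampFidelity_le_genFidelity _ _).trans (le_of_eq ?_)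
  rw [key, key, hY, fromCols_mul_conjTranspose, hS]
  simp

end PurifiedDistance

/-! ### Operators of the form `1 ⊗ T` -/

section Kronecker

variable {a b n k : Type*} [Fintype a] [Fintype b] [Fintype n] [Fintype k]
  [DecidableEq a] [DecidableEq b] [DecidableEq n] [DecidableEq k]

theorem one_kronecker_mono {A B : Matrix n n ℂ} (h : A ≤ B) :
    (1 : Matrix a a ℂ) ⊗ₖ A ≤ 1 ⊗ₖ B := by
  rw [Matrix.le_iff] at h ⊢
  have : (1 : Matrix a a ℂ) ⊗ₖ B - 1 ⊗ₖ A = 1 ⊗ₖ (B - A) := by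
    ext ⟨i, j⟩ ⟨i', j'⟩
    simp [mul_sub]
  rw [this]
  exact Matrix.PosSemidef.one.kronecker h

theorem one_kronecker_posSemidef {A : Matrix n n ℂ} (h : A.PosSemidef) :
    ((1 : Matrix a a ℂ) ⊗ₖ A).PosSemidef :=
  Matrix.PosSemidef.one.kronecker h

theorem reshape_symm_mul (T : Matrix n n ℂ) (X : Matrix (a × n) k ℂ) :
    reshape (slideEquiv a n k).symm (T * reshape (slideEquiv a n k) X) =
      ((1 : Matrix a a ℂ) ⊗ₖ T) * X := by
  ext ⟨i, j⟩ p
  simp [reshape, slideEquiv, Matrix.mul_apply, Fintype.sum_prod_type, Matrix.one_apply]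

theorem one_kronecker_conj (T A : Matrix n n ℂ) :
    ((1 : Matrix a a ℂ) ⊗ₖ T) * ((1 : Matrix a a ℂ) ⊗ₖ A) * ((1 : Matrix a a ℂ) ⊗ₖ T)ᴴ =
      (1 : Matrix a a ℂ) ⊗ₖ (T * A * Tᴴ) := by
  rw [Matrix.conjTranspose_kronecker, ← Matrix.mul_kronecker_mul, ← Matrix.mul_kronecker_mul]
  simp

end Kronecker

/-! ### Filtering the purifying system -/

section Filter

variable {n k l : Type*} [Fintype n] [Fintype k] [Fintype l]
  [DecidableEq n] [DecidableEq k] [DecidableEq l]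

/-- The generalized fidelity does not decrease when a contraction is applied to the purifying
system. -/
theorem ampFidelity_le_mul_contraction {X Y : Matrix n k ℂ} (hX : overlap X X ≤ 1)
    (hY : overlap Y Y ≤ 1) {Q : Matrix k l ℂ} (hQ : IsContraction Q) :
    ampFidelity X Y ≤ ampFidelity (X * Q) (Y * Q) := by
  have hT : (1 - Q * Qᴴ).PosSemidef := by
    have := Matrix.le_iff.1 hQ.conjTranspose
    simpa using this
  have hR := sqrt_mul_conjTranspose_sqrt hT
  set R := CFC.sqrt (1 - Q * Qᴴ)
  have split : ∀ U V : Matrix n k ℂ,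
      overlap U V = overlap (U * Q) (V * Q) + overlap (U * R) (V * R) := by
    intro U V
    have h1 : overlap (U * Q) (V * Q) = (Uᴴ * V * (Q * Qᴴ)).trace.re := by
      rw [overlap, Matrix.conjTranspose_mul, Matrix.mul_assoc, Matrix.trace_mul_comm]
      simp only [Matrix.mul_assoc]
    have h2 : overlap (U * R) (V * R) = (Uᴴ * V * (R * Rᴴ)).trace.re := by
      rw [overlap, Matrix.conjTranspose_mul, Matrix.mul_assoc, Matrix.trace_mul_comm]
      simp only [Matrix.mul_assoc]
    rw [h1, h2, hR, Matrix.mul_sub, Matrix.trace_sub, Matrix.mul_one, Complex.sub_re, overlap]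
    ring
  -- The overlap discarded in the `R` block is absorbed by the extra coordinate, whose square grows
  -- by exactly the discarded mass.
  have h := overlap_add_mul_le (X * R) (Y * R) (Real.sqrt (1 - overlap X X))
    (Real.sqrt (1 - overlap Y Y))
  have hX' := split X X
  have hY' := split Y Y
  rw [Real.sq_sqrt (by linarith), Real.sq_sqrt (by linarith)] at h
  have e1 : overlap (X * R) (X * R) + (1 - overlap X X) = 1 - overlap (X * Q) (X * Q) := by
    linarith
  have e2 : overlap (Y * R) (Y * R) + (1 - overlap Y Y) = 1 - overlap (Y * Q) (Y * Q) := by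
    linarith
  rw [e1, e2] at h
  have h1 := hQ.overlap_self_le X
  rw [ampFidelity, ampFidelity, Real.sqrt_mul (by linarith), Real.sqrt_mul (by linarith),
    split X Y]
  linarith

/-- The resolvent filter `Zᴴ (Z Zᴴ + δ σ)⁻¹ Z` on the purifying system. -/
noncomputable def resolventFilter (Z : Matrix n k ℂ) (δ : ℝ) (σ : Matrix n n ℂ) : Matrix k k ℂ :=
  Zᴴ * (Z * Zᴴ + δ • σ)⁻¹ * Z

section

variable {Z : Matrix n k ℂ} {δ : ℝ} {σ : Matrix n n ℂ}

theorem posDef_add_smul (Z : Matrix n k ℂ) (hδ : 0 < δ) (hσ : σ.PosDef) :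
    (Z * Zᴴ + δ • σ).PosDef :=
  Matrix.PosDef.posSemidef_add (Matrix.posSemidef_self_mul_conjTranspose Z) (hσ.smul hδ)

theorem conjTranspose_resolventFilter (hδ : 0 < δ) (hσ : σ.PosDef) :
    (resolventFilter Z δ σ)ᴴ = resolventFilter Z δ σ := by
  have := (posDef_add_smul Z hδ hσ).inv.isHermitian.eq
  simp only [resolventFilter, Matrix.conjTranspose_mul, Matrix.conjTranspose_conjTranspose, this,
    Matrix.mul_assoc]

theorem resolventFilter_le_one (hδ : 0 < δ) (hσ : σ.PosDef) : resolventFilter Z δ σ ≤ 1 := by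
  refine conjTranspose_mul_inv_mul_le_one (posDef_add_smul Z hδ hσ) ?_
  rw [Matrix.le_iff]
  simpa using (hσ.smul hδ).posSemidef

/-- Writing `S = Z Zᴴ + δ σ`, the middle factor `Z Zᴴ` of the square is `S - δ σ`. This turns a
conjugate of `σ` into a function of the filter alone. -/
theorem resolventFilter_sub_sq (hδ : 0 < δ) (hσ : σ.PosDef) :
    resolventFilter Z δ σ - resolventFilter Z δ σ * resolventFilter Z δ σ =
      δ • (Zᴴ * (Z * Zᴴ + δ • σ)⁻¹ * σ * (Zᴴ * (Z * Zᴴ + δ • σ)⁻¹)ᴴ) := by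
  have hS := posDef_add_smul Z hδ hσ
  have hH := hS.inv.isHermitian.eq
  have hdet := (Matrix.isUnit_iff_isUnit_det _).1 hS.isUnit
  unfold resolventFilter
  rw [Matrix.conjTranspose_mul, hH, Matrix.conjTranspose_conjTranspose]
  set S := Z * Zᴴ + δ • σ with hSdef
  have hZ : Z * Zᴴ = S - δ • σ := by simp [hSdef]
  have e : Zᴴ * S⁻¹ * Z * (Zᴴ * S⁻¹ * Z) = Zᴴ * (S⁻¹ * (Z * Zᴴ) * S⁻¹) * Z := by
    simp only [Matrix.mul_assoc]
  have e2 : S⁻¹ * (Z * Zᴴ) * S⁻¹ = S⁻¹ - δ • (S⁻¹ * σ * S⁻¹) := by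
    rw [hZ, Matrix.mul_sub, Matrix.nonsing_inv_mul _ hdet, Matrix.sub_mul]
    simp
  rw [e, e2]
  simp only [Matrix.mul_sub, Matrix.sub_mul, Matrix.mul_smul, Matrix.smul_mul, Matrix.mul_assoc]
  simp

theorem resolventFilter_sq_le (hδ : 0 < δ) (hσ : σ.PosDef) :
    resolventFilter Z δ σ * resolventFilter Z δ σ ≤ resolventFilter Z δ σ := by
  rw [Matrix.le_iff, resolventFilter_sub_sq hδ hσ]
  exact (hσ.posSemidef.mul_mul_conjTranspose_same _).smul hδ.le

theorem resolventFilter_sub_sq_le (hδ : 0 < δ) (hσ : σ.PosDef) :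
    resolventFilter Z δ σ - resolventFilter Z δ σ * resolventFilter Z δ σ ≤
      (1 / 4 : ℝ) • (1 : Matrix k k ℂ) := by
  have hH := conjTranspose_resolventFilter (Z := Z) hδ hσ
  set Q := resolventFilter Z δ σ
  -- The constant `1/4` comes from `(1/2 - Q)² ≥ 0`.
  have h := Matrix.posSemidef_self_mul_conjTranspose ((1 / 2 : ℝ) • (1 : Matrix k k ℂ) - Q)
  rw [Matrix.le_iff]
  refine Eq.subst ?_ h
  rw [Matrix.conjTranspose_sub, hH, Matrix.conjTranspose_smul, Matrix.conjTranspose_one]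
  simp only [Matrix.mul_sub, Matrix.sub_mul, Matrix.smul_mul, Matrix.mul_smul, Matrix.one_mul,
    Matrix.mul_one, star_trivial]
  module

theorem isContraction_resolventFilter (hδ : 0 < δ) (hσ : σ.PosDef) :
    IsContraction (resolventFilter Z δ σ) := by
  rw [IsContraction, conjTranspose_resolventFilter hδ hσ]
  exact (resolventFilter_sq_le hδ hσ).trans (resolventFilter_le_one hδ hσ)

/-- Substituting `Z Zᴴ = S - δ σ` twice gives `Z Q Zᴴ = Z Zᴴ - δ σ + δ² σ S⁻¹ σ`, so the overlap
drops by at most `δ`. The square-root term is at least `1 - overlap Z Z`, since the filter only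
removes mass. -/
theorem le_ampFidelity_resolventFilter (hδ : 0 < δ) (hσ : σ.PosDef) (htr : σ.trace.re ≤ 1)
    (hZ : overlap Z Z ≤ 1) :
    1 - δ ≤ ampFidelity Z (Z * resolventFilter Z δ σ) := by
  have hS := posDef_add_smul Z hδ hσ
  have hdet := (Matrix.isUnit_iff_isUnit_det _).1 hS.isUnit
  have hH := conjTranspose_resolventFilter (Z := Z) hδ hσ
  set Q := resolventFilter Z δ σ with hQ
  set S := Z * Zᴴ + δ • σ with hSdef
  have hr : Z * Zᴴ = S - δ • σ := by simp [hSdef]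
  have hp : overlap Z (Z * Q) = (Z * Q * Zᴴ).trace.re := by
    rw [overlap, Matrix.trace_mul_comm]
  have hq : overlap (Z * Q) (Z * Q) ≤ overlap Z (Z * Q) := by
    rw [hp, overlap_self_eq, Matrix.conjTranspose_mul, hH]
    have := mul_mul_conjTranspose_mono (resolventFilter_sq_le (Z := Z) hδ hσ) Z
    rw [← hQ] at this
    simpa [Matrix.mul_assoc] using re_trace_mono this
  have hpt : overlap Z (Z * Q) ≤ overlap Z Z := by
    rw [hp, overlap_self_eq]
    have := mul_mul_conjTranspose_mono (resolventFilter_le_one (Z := Z) hδ hσ) Z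
    rw [← hQ] at this
    simpa using re_trace_mono this
  have hpδ : overlap Z Z - δ ≤ overlap Z (Z * Q) := by
    have e : Z * Q * Zᴴ = Z * Zᴴ - δ • σ + (δ ^ 2) • (σ * S⁻¹ * σᴴ) := by
      have : Z * Q * Zᴴ = (Z * Zᴴ) * S⁻¹ * (Z * Zᴴ) := by
        rw [hQ, resolventFilter, ← hSdef]
        simp only [Matrix.mul_assoc]
      rw [this, hr, Matrix.sub_mul, Matrix.mul_nonsing_inv _ hdet, Matrix.sub_mul,
        Matrix.mul_sub, Matrix.mul_sub, hσ.isHermitian.eq, Matrix.smul_mul, Matrix.smul_mul,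
        Matrix.mul_assoc σ, Matrix.nonsing_inv_mul _ hdet]
      simp only [Matrix.one_mul, Matrix.mul_one, Matrix.mul_smul]
      simp only [Matrix.smul_mul]
      module
    have h1 := re_trace_nonneg (hS.inv.posSemidef.mul_mul_conjTranspose_same σ)
    rw [hp, e, overlap_self_eq]
    simp only [Matrix.trace_add, Matrix.trace_sub, Matrix.trace_smul, Complex.add_re,
      Complex.sub_re, Complex.smul_re, smul_eq_mul]
    have h2 : 0 ≤ δ ^ 2 * (σ * S⁻¹ * σᴴ).trace.re := by positivity
    nlinarith
  have hs : 1 - overlap Z Z ≤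
      Real.sqrt ((1 - overlap Z Z) * (1 - overlap (Z * Q) (Z * Q))) := by
    apply Real.le_sqrt_of_sq_le
    nlinarith
  rw [ampFidelity]
  linarith

end

end Filter

/-! ### Changing the reference operator of a min-entropy bound -/

section Core

variable {a n k : Type*} [Fintype a] [Fintype n] [Fintype k]
  [DecidableEq a] [DecidableEq n] [DecidableEq k]

/-- Averaging with the maximally mixed state makes the resolvent invertible; the factor `2` is later
absorbed by the `1/4` from `Q - Q²`. -/
theorem exists_posDef_ge {σ : Matrix n n ℂ} (hσ : IsSubnormalized σ) :
    ∃ σ' : Matrix n n ℂ, σ'.PosDef ∧ σ'.trace.re ≤ 1 ∧ σ ≤ (2 : ℝ) • σ' := by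
  cases isEmpty_or_nonempty n
  · refine ⟨0, ?_, by simp, ?_⟩
    · have : (0 : Matrix n n ℂ) = 1 := Subsingleton.elim _ _
      rw [this]
      exact Matrix.PosDef.one
    · exact le_of_eq (Subsingleton.elim _ _)
  have hd : (0 : ℝ) < Fintype.card n := by exact_mod_cast Fintype.card_pos
  have h1 : ((Fintype.card n : ℝ)⁻¹ • (1 : Matrix n n ℂ)).PosDef :=
    Matrix.PosDef.one.smul (by positivity)
  refine ⟨(1 / 2 : ℝ) • (σ + (Fintype.card n : ℝ)⁻¹ • 1),
    (Matrix.PosDef.posSemidef_add hσ.1 h1).smul (by positivity), ?_, ?_⟩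
  · have := hσ.2
    simp only [Matrix.trace_smul, Matrix.trace_add, Complex.smul_re, Complex.add_re,
      Matrix.trace_one, smul_eq_mul, Complex.natCast_re]
    rw [inv_mul_cancel₀ hd.ne']
    linarith
  · rw [Matrix.le_iff, smul_smul]
    norm_num
    simpa using h1.posSemidef

/-- A state with large min-entropy relative to some `σ` is close to one with large min-entropy
relative to any operator close to its marginal. -/
theorem exists_close_le_one_kronecker {ρ : Matrix (a × n) (a × n) ℂ} (hρ : IsSubnormalized ρ)
    {σ : Matrix n n ℂ} (hσ : IsSubnormalized σ) {c : ℝ} (hc : 0 ≤ c)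
    (h : ρ ≤ c • ((1 : Matrix a a ℂ) ⊗ₖ σ)) {τ : Matrix n n ℂ} (hτ : IsSubnormalized τ)
    {δ : ℝ} (hδ : 0 < δ) (hδ1 : δ ≤ 1) :
    ∃ ω : Matrix (a × n) (a × n) ℂ, IsSubnormalized ω ∧
      ω ≤ (c / δ) • ((1 : Matrix a a ℂ) ⊗ₖ τ) ∧
      purifiedDist ω ρ ≤ purifiedDist τ (traceFirst ρ) + Real.sqrt (1 - (1 - δ) ^ 2) := by
  obtain ⟨σ', hσ', htr, hle⟩ := exists_posDef_ge hσ
  obtain ⟨X, hX⟩ : ∃ X : Matrix (a × n) (a × n) ℂ, X * Xᴴ = ρ :=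
    ⟨_, sqrt_mul_conjTranspose_sqrt hρ.1⟩
  set e := slideEquiv a n (a × n)
  set Z := reshape e X with hZ
  have hZZ : Z * Zᴴ = traceFirst ρ := by rw [hZ, slide_mul_conjTranspose, hX]
  have hX1 : overlap X X ≤ 1 := overlap_self_le_one hρ hX.le
  have hZ1 : overlap Z Z ≤ 1 := by rw [hZ, overlap_reshape]; exact hX1
  obtain ⟨Y, hY, hYF⟩ := exists_amplitude_le Z hZ1 hτ.1
  have hY1 := overlap_self_le_one hτ hY
  set Q := resolventFilter Z δ σ' with hQ
  have hQc : IsContraction Q := isContraction_resolventFilter hδ hσ'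
  -- The filter acts on the columns of `Y`, but its last factor `Z` lets `Y * Q` be read as `T`
  -- acting on the rows of `Z`.
  set T := Y * (Zᴴ * (Z * Zᴴ + δ • σ')⁻¹) with hT
  have hYQ : Y * Q = T * Z := by
    rw [hT, hQ, resolventFilter]
    simp only [Matrix.mul_assoc]
  have hXe : ∀ V : Matrix n (a × (a × n)) ℂ, overlap (reshape e.symm V) (reshape e.symm V)
      = overlap V V := fun V => overlap_reshape _ _ _
  have hXZ : X = reshape e.symm Z := by
    rw [hZ]; exact (reshape_symm_reshape e.symm X).symm
  have hω : IsSubnormalized (reshape e.symm (Y * Q) * (reshape e.symm (Y * Q))ᴴ) :=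
    isSubnormalized_mul_conjTranspose (by rw [hXe]; exact (hQc.overlap_self_le Y).trans hY1)
  have hω' : IsSubnormalized (reshape e.symm (Z * Q) * (reshape e.symm (Z * Q))ᴴ) :=
    isSubnormalized_mul_conjTranspose (by rw [hXe]; exact (hQc.overlap_self_le Z).trans hZ1)
  -- The intermediate state is the filtered `Z`: its distance to the filtered `Y` is controlled by
  -- that of `τ` to the marginal, its distance to `ρ` by `δ`.
  refine ⟨_, hω, ?_, (purifiedDist_triangle hω hω' hρ).trans (add_le_add ?_ ?_)⟩
  · have hTσ : T * σ * Tᴴ ≤ δ⁻¹ • τ := by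
      have h1 := mul_mul_conjTranspose_mono hle T
      have h2 : T * ((2 : ℝ) • σ') * Tᴴ = (2 / δ) • (Y * (Q - Q * Q) * Yᴴ) := by
        rw [hQ, resolventFilter_sub_sq hδ hσ', hT, Matrix.conjTranspose_mul]
        simp only [Matrix.mul_smul, Matrix.smul_mul, smul_smul, Matrix.mul_assoc]
        rw [div_mul_cancel₀ _ hδ.ne']
      have h3 := mul_mul_conjTranspose_mono (resolventFilter_sub_sq_le (Z := Z) hδ hσ') Y
      have h4 := smul_mono_of_nonneg (c := 2 / δ) (by positivity) h3
      have h5 := smul_mono_of_nonneg (c := 1 / (2 * δ)) (by positivity) hY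
      have h6 := smul_mono_of_nonneg (c := 1 / (2 * δ)) (by positivity)
        (Matrix.nonneg_iff_posSemidef.2 hτ.1)
      rw [h2] at h1
      refine h1.trans (h4.trans ?_)
      have e1 : (2 / δ) • (Y * ((1 / 4 : ℝ) • (1 : Matrix (a × (a × n)) (a × (a × n)) ℂ)) * Yᴴ)
          = (1 / (2 * δ)) • (Y * Yᴴ) := by
        simp only [Matrix.mul_smul, Matrix.smul_mul, Matrix.mul_one, smul_smul]
        congr 1
        field_simp
        norm_num
      rw [e1]
      refine h5.trans ?_
      rw [smul_zero] at h6
      calc (1 / (2 * δ)) • τ ≤ (1 / (2 * δ)) • τ + (1 / (2 * δ)) • τ := by simpa using h6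
        _ = δ⁻¹ • τ := by
          rw [← add_smul]
          congr 1
          field_simp
          norm_num
    rw [hYQ, hZ, reshape_symm_mul, Matrix.conjTranspose_mul, Matrix.mul_assoc,
      ← Matrix.mul_assoc X, hX, ← Matrix.mul_assoc]
    refine (mul_mul_conjTranspose_mono h _).trans ?_
    rw [Matrix.mul_smul, Matrix.smul_mul, one_kronecker_conj]
    have := smul_mono_of_nonneg hc (one_kronecker_mono (a := a) hTσ)
    rwa [Matrix.kronecker_smul, smul_smul, ← div_eq_mul_inv] at this
  · have h1 := ampFidelity_le_mul_contraction hZ1 hY1 hQc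
    rw [purifiedDist_comm hω.1 hω'.1, purifiedDist_comm hτ.1 (traceFirst_posSemidef hρ.1)]
    apply purifiedDist_le_of_genFidelity_le
    rw [← hZZ]
    refine hYF.trans (h1.trans ?_)
    rw [← ampFidelity_reshape e.symm]
    exact ampFidelity_le_genFidelity _ _
  · have h1 := le_ampFidelity_resolventFilter hδ hσ' htr hZ1
    rw [← ampFidelity_reshape e.symm, ← hXZ, ← hQ] at h1
    have h2 := h1.trans (ampFidelity_le_genFidelity _ _)
    rw [hX] at h2
    rw [purifiedDist_comm hω'.1 hρ.1]
    apply Real.sqrt_le_sqrt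
    have := pow_le_pow_left₀ (by linarith) h2 2
    linarith

end Core

/-! ### From min-entropy to max-entropy: Cauchy–Schwarz -/

section WeakDuality

variable {a b k l : Type*} [Fintype a] [Fintype b] [Fintype k] [Fintype l]
  [DecidableEq a] [DecidableEq b] [DecidableEq k] [DecidableEq l]

/-- Exchanging the purifying system with the second tensor factor of the row space. -/
def dualEquiv (a b k : Type*) : (a × b) × k ≃ (a × k) × b where
  toFun p := ((p.1.1, p.2), p.1.2)
  invFun p := ((p.1.1, p.2), p.1.2)
  left_inv _ := rfl
  right_inv _ := rfl

theorem dual_kronecker_mul (T : Matrix b l ℂ) (W : Matrix (a × l) k ℂ) :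
    reshape (dualEquiv a b k) (((1 : Matrix a a ℂ) ⊗ₖ T) * W) =
      reshape (dualEquiv a l k) W * Tᵀ := by
  ext ⟨i, j⟩ p
  simp [reshape, dualEquiv, Matrix.mul_apply, Fintype.sum_prod_type, Matrix.one_apply, mul_comm]

theorem dual_mul_transpose (W : Matrix (a × b) k ℂ) (R : Matrix k k ℂ) :
    reshape (dualEquiv a b k) (W * Rᵀ) =
      ((1 : Matrix a a ℂ) ⊗ₖ R) * reshape (dualEquiv a b k) W := by
  ext ⟨i, j⟩ p
  simp [reshape, dualEquiv, Matrix.mul_apply, Fintype.sum_prod_type, Matrix.one_apply, mul_comm]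

theorem IsContraction.overlap_mul_left_le {W : Matrix l k ℂ} (h : IsContraction W)
    (M : Matrix k b ℂ) : overlap (W * M) (W * M) ≤ overlap M M := by
  have := re_trace_mono (conjTranspose_mul_mul_mono h M)
  rw [overlap, overlap]
  simpa [Matrix.mul_assoc] using this

theorem overlap_transpose (X Y : Matrix k l ℂ) : overlap Xᵀ Yᵀ = overlap X Y := by
  rw [overlap_eq_sum, overlap_eq_sum]
  exact Equiv.sum_comp (Equiv.prodComm l k) fun p : k × l => (star (X p.1 p.2) * Y p.1 p.2).re

theorem one_kronecker_mul_conjTranspose (T : Matrix b l ℂ) :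
    ((1 : Matrix a a ℂ) ⊗ₖ T) * ((1 : Matrix a a ℂ) ⊗ₖ T)ᴴ = (1 : Matrix a a ℂ) ⊗ₖ (T * Tᴴ) := by
  rw [Matrix.conjTranspose_kronecker, ← Matrix.mul_kronecker_mul]
  simp

/-- A min-entropy bound for one marginal of a pure state bounds the max-entropy of the
complementary marginal. -/
theorem fidelity_sq_le_of_dual_le (X : Matrix (a × b) k ℂ) {σ : Matrix k k ℂ}
    (hσ : IsSubnormalized σ) {c : ℝ} (hc : 0 ≤ c)
    (h : reshape (dualEquiv a b k) X * (reshape (dualEquiv a b k) X)ᴴ ≤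
      c • ((1 : Matrix a a ℂ) ⊗ₖ σ)) {ω : Matrix b b ℂ} (hω : IsSubnormalized ω) :
    fidelity (X * Xᴴ) ((1 : Matrix a a ℂ) ⊗ₖ ω) ^ 2 ≤ c := by
  obtain ⟨S, hS⟩ : ∃ S : Matrix b b ℂ, S * Sᴴ = ω := ⟨_, sqrt_mul_conjTranspose_sqrt hω.1⟩
  obtain ⟨R, hR⟩ : ∃ R : Matrix k k ℂ, R * Rᴴ = σ := ⟨_, sqrt_mul_conjTranspose_sqrt hσ.1⟩
  obtain ⟨W, hW, hF⟩ := exists_overlap_mul_eq_fidelity X ((1 : Matrix a a ℂ) ⊗ₖ S)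
  rw [one_kronecker_mul_conjTranspose, hS] at hF
  set X' := reshape (dualEquiv a b k) X with hX'
  set W' := reshape (dualEquiv a b k) W with hW'
  -- Cauchy–Schwarz is applied to this overlap: `Sᵀ` has squared norm `tr ω ≤ 1`, and the hypothesis
  -- bounds that of `W'ᴴ * X'` by `c tr (W'ᴴ (1 ⊗ σ) W') ≤ c`, because `W` is a contraction and `tr
  -- σ ≤ 1`.
  have h1 : fidelity (X * Xᴴ) ((1 : Matrix a a ℂ) ⊗ₖ ω) = overlap (W'ᴴ * X') Sᵀ := by
    rw [← hF, ← overlap_reshape (dualEquiv a b k), dual_kronecker_mul, overlap_mul_left]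
  have h2 : overlap Sᵀ Sᵀ ≤ 1 := by
    rw [overlap_transpose, overlap_self_eq, hS]
    exact hω.2
  have h3 : overlap (W'ᴴ * X') (W'ᴴ * X') ≤ c := by
    have e1 := re_trace_mono (conjTranspose_mul_mul_mono h W')
    have e2 : W'ᴴ * (((1 : Matrix a a ℂ) ⊗ₖ σ)) * W' =
        (reshape (dualEquiv a b k) (W * Rᴴᵀ))ᴴ * reshape (dualEquiv a b k) (W * Rᴴᵀ) := by
      have e : (1 : Matrix a a ℂ) ⊗ₖ σ =
          ((1 : Matrix a a ℂ) ⊗ₖ Rᴴ)ᴴ * ((1 : Matrix a a ℂ) ⊗ₖ Rᴴ) := by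
        rw [Matrix.conjTranspose_kronecker, ← Matrix.mul_kronecker_mul]
        simp [hR]
      rw [dual_mul_transpose, e, Matrix.conjTranspose_mul, ← hW']
      simp only [Matrix.mul_assoc]
    have e3 : (W'ᴴ * (((1 : Matrix a a ℂ) ⊗ₖ σ)) * W').trace.re ≤ 1 := by
      rw [e2]
      change overlap _ _ ≤ 1
      rw [overlap_reshape]
      refine (hW.overlap_mul_left_le _).trans ?_
      rw [overlap_transpose, overlap, Matrix.conjTranspose_conjTranspose, hR]
      exact hσ.2
    rw [Matrix.mul_smul, Matrix.smul_mul, Matrix.trace_smul, Complex.smul_re, smul_eq_mul] at e1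
    rw [overlap_self_eq, Matrix.conjTranspose_mul, Matrix.conjTranspose_conjTranspose]
    calc _ = (W'ᴴ * (X' * X'ᴴ) * W').trace.re := by simp only [Matrix.mul_assoc]
      _ ≤ _ := e1
      _ ≤ c * 1 := by gcongr
      _ = c := mul_one c
  have h4 := overlap_le_sqrt (W'ᴴ * X') Sᵀ
  have h5 : fidelity (X * Xᴴ) ((1 : Matrix a a ℂ) ⊗ₖ ω) ≤ Real.sqrt c := by
    rw [h1]
    calc _ ≤ _ := h4
      _ ≤ Real.sqrt c * Real.sqrt 1 := by gcongr
      _ = _ := by simp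
  calc _ ≤ Real.sqrt c ^ 2 := pow_le_pow_left₀ (fidelity_nonneg _ _) h5 2
    _ = c := Real.sq_sqrt hc

end WeakDuality

/-! ### From max-entropy to min-entropy: separation -/

section StrongDuality

variable {a b k l : Type*} [Fintype a] [Fintype b] [Fintype k] [Fintype l]
  [DecidableEq a] [DecidableEq b] [DecidableEq k] [DecidableEq l]

theorem isClosed_posSemidef : IsClosed {M : Matrix k k ℂ | M.PosSemidef} := by
  have : {M : Matrix k k ℂ | M.PosSemidef} =
      {M | Mᴴ = M} ∩ ⋂ v : k → ℂ, {M | 0 ≤ star v ⬝ᵥ (M *ᵥ v)} := by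
    ext M
    simp [Matrix.posSemidef_iff_dotProduct_mulVec, Matrix.IsHermitian]
  rw [this]
  refine (isClosed_eq (by fun_prop) continuous_id).inter (isClosed_iInter fun v => ?_)
  exact isClosed_le continuous_const (by fun_prop)

theorem isCompact_overlap_self_le_one : IsCompact {S : Matrix k l ℂ | overlap S S ≤ 1} := by
  have hc : IsCompact (Set.univ.pi fun _ : k => Set.univ.pi fun _ : l =>
      Metric.closedBall (0 : ℂ) 1) :=
    isCompact_univ_pi fun _ => isCompact_univ_pi fun _ => isCompact_closedBall _ _
  have hcl : IsClosed {S : Matrix k l ℂ | overlap S S ≤ 1} := by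
    refine isClosed_le ?_ continuous_const
    unfold overlap
    fun_prop
  have hbound : ∀ S : Matrix k l ℂ, overlap S S ≤ 1 → ∀ i j, ‖S i j‖ ≤ 1 := by
    intro S hS i j
    have h1 : ∀ p : k × l, (star (S p.1 p.2) * S p.1 p.2).re = ‖S p.1 p.2‖ ^ 2 := by
      intro p
      rw [RCLike.star_def, ← Complex.normSq_eq_conj_mul_self, Complex.ofReal_re,
        Complex.normSq_eq_norm_sq]
    rw [overlap_eq_sum] at hS
    simp only [h1] at hS
    have h2 := Finset.single_le_sum (f := fun p : k × l => ‖S p.1 p.2‖ ^ 2)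
      (fun p _ => by positivity) (Finset.mem_univ (i, j))
    have h3 : ‖S i j‖ ^ 2 ≤ 1 := h2.trans hS
    nlinarith [norm_nonneg (S i j)]
  refine hc.of_isClosed_subset hcl fun S hS => ?_
  simp only [Set.mem_pi, Set.mem_univ, true_imp_iff, mem_closedBall_zero_iff]
  exact hbound S hS

/-- Every real-linear functional on complex matrices is a trace pairing. -/
theorem exists_re_trace_mul_eq (f : Matrix k k ℂ →ₗ[ℝ] ℝ) :
    ∃ E : Matrix k k ℂ, ∀ X, f X = (E * X).trace.re := by
  refine ⟨Matrix.of fun j i => (f (Matrix.single i j 1) : ℂ)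
    - Complex.I * (f (Matrix.single i j Complex.I) : ℂ), fun X => ?_⟩
  have h : ∀ i j, f (Matrix.single i j (X i j)) =
      (X i j).re * f (Matrix.single i j 1) + (X i j).im * f (Matrix.single i j Complex.I) := by
    intro i j
    have : Matrix.single i j (X i j) = (X i j).re • Matrix.single i j (1 : ℂ)
        + (X i j).im • Matrix.single i j Complex.I := by
      rw [Matrix.smul_single, Matrix.smul_single, ← Matrix.single_add]
      congr 1
      apply Complex.ext <;> simp
    rw [this, map_add, map_smul, map_smul, smul_eq_mul, smul_eq_mul]
  conv_lhs => rw [Matrix.matrix_eq_sum_single X]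
  simp only [map_sum, h, Matrix.trace, Matrix.diag_apply, Matrix.mul_apply, Complex.re_sum]
  rw [Finset.sum_comm]
  refine Finset.sum_congr rfl fun i _ => Finset.sum_congr rfl fun j _ => ?_
  simp
  ring

theorem trace_mul_one_kronecker (E : Matrix (a × k) (a × k) ℂ) (σ : Matrix k k ℂ) :
    (E * ((1 : Matrix a a ℂ) ⊗ₖ σ)).trace = (traceFirst E * σ).trace := by
  simp only [Matrix.trace, Matrix.diag_apply, Matrix.mul_apply, traceFirst, Matrix.of_apply,
    Fintype.sum_prod_type, Matrix.kroneckerMap_apply, Matrix.one_apply, ite_mul, one_mul, zero_mul,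
    mul_ite, mul_zero, Finset.sum_mul]
  rw [Finset.sum_comm]
  refine Finset.sum_congr rfl fun i _ => ?_
  rw [Finset.sum_comm]
  conv_rhs => rw [Finset.sum_comm]
  rw [Finset.sum_comm]
  refine Finset.sum_congr rfl fun j _ => ?_
  rw [Finset.sum_comm]
  refine Finset.sum_congr rfl fun x _ => ?_
  simp

theorem trace_mul_vecMulVec (E : Matrix k k ℂ) (v : k → ℂ) :
    (E * Matrix.vecMulVec v (star v)).trace = star v ⬝ᵥ (E *ᵥ v) := by
  rw [Matrix.mul_vecMulVec, Matrix.trace_vecMulVec, dotProduct_comm]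

theorem IsSubnormalized.zero : IsSubnormalized (0 : Matrix k k ℂ) :=
  ⟨Matrix.PosSemidef.zero, by simp⟩

theorem IsSubnormalized.convex : Convex ℝ {σ : Matrix k k ℂ | IsSubnormalized σ} := by
  intro σ hσ τ hτ s t hs ht hst
  have h1 : (s • σ + t • τ).trace.re = s * σ.trace.re + t * τ.trace.re := by
    simp [Matrix.trace_add, Matrix.trace_smul]
  refine ⟨(hσ.1.smul hs).add (hτ.1.smul ht), ?_⟩
  have := hσ.2
  have := hτ.2
  rw [h1]
  nlinarith

theorem isCompact_isSubnormalized : IsCompact {σ : Matrix k k ℂ | IsSubnormalized σ} := by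
  have h := (isCompact_overlap_self_le_one (k := k) (l := k)).image
    (f := fun S : Matrix k k ℂ => S * Sᴴ) (by fun_prop)
  convert h using 1
  ext σ
  constructor
  · intro hσ
    have h1 := sqrt_mul_conjTranspose_sqrt hσ.1
    exact ⟨CFC.sqrt σ, overlap_self_le_one hσ h1.le, h1⟩
  · rintro ⟨S, hS, rfl⟩
    exact isSubnormalized_mul_conjTranspose hS

theorem isSubnormalized_smul_vecMulVec (v : k → ℂ) {s : ℝ} (hs : 0 ≤ s)
    (h : s * (star v ⬝ᵥ v).re ≤ 1) :
    IsSubnormalized (s • Matrix.vecMulVec v (star v)) := by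
  refine ⟨(Matrix.posSemidef_vecMulVec_self_star v).smul hs, ?_⟩
  rw [Matrix.trace_smul, Matrix.trace_vecMulVec, Complex.smul_re, dotProduct_comm]
  exact h

theorem re_trace_hermitianPart_mul (E : Matrix k k ℂ) {X : Matrix k k ℂ} (hX : X.IsHermitian) :
    (((1 / 2 : ℝ) • (E + Eᴴ)) * X).trace.re = (E * X).trace.re := by
  have h : (Eᴴ * X).trace.re = (E * X).trace.re := by
    rw [← Complex.conj_re, ← RCLike.star_def, ← Matrix.trace_conjTranspose,
      Matrix.conjTranspose_mul, hX.eq, Matrix.conjTranspose_conjTranspose, Matrix.trace_mul_comm]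
  rw [Matrix.smul_mul, Matrix.add_mul, Matrix.trace_smul, Matrix.trace_add, Complex.smul_re,
    Complex.add_re, h, smul_eq_mul]
  ring

theorem posSemidef_of_re_nonneg {E : Matrix k k ℂ} (hE : E.IsHermitian)
    (h : ∀ v, 0 ≤ (star v ⬝ᵥ (E *ᵥ v)).re) : E.PosSemidef :=
  Matrix.PosSemidef.of_dotProduct_mulVec_nonneg hE fun v =>
    Complex.nonneg_iff.2 ⟨h v, (hE.im_star_dotProduct_mulVec_self v).symm⟩

instance : LocallyConvexSpace ℝ (Matrix k k ℂ) :=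
  inferInstanceAs (LocallyConvexSpace ℝ (k → k → ℂ))

/-- Strong duality of the semidefinite program for the conditional min-entropy. -/
theorem exists_le_smul_one_kronecker {M : Matrix (a × k) (a × k) ℂ} (hM : M.PosSemidef) {c : ℝ}
    (hc : 0 < c)
    (h : ∀ E : Matrix (a × k) (a × k) ℂ, E.PosSemidef → traceFirst E ≤ 1 →
      (E * M).trace.re ≤ c) :
    ∃ σ : Matrix k k ℂ, IsSubnormalized σ ∧ M ≤ c • ((1 : Matrix a a ℂ) ⊗ₖ σ) := by
  by_contra hcon
  push Not at hcon
  let L : Matrix k k ℂ →ₗ[ℝ] Matrix (a × k) (a × k) ℂ :=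
    { toFun := fun σ => c • ((1 : Matrix a a ℂ) ⊗ₖ σ)
      map_add' := fun x y => by rw [Matrix.kronecker_add, smul_add]
      map_smul' := fun r x => by
        rw [Matrix.kronecker_smul, smul_comm]
        rfl }
  have hLc : Continuous L := by
    change Continuous fun σ : Matrix k k ℂ => c • ((1 : Matrix a a ℂ) ⊗ₖ σ)
    refine Continuous.const_smul ?_ c
    refine continuous_matrix fun i j => ?_
    simp only [Matrix.kroneckerMap_apply]
    fun_prop
  -- The operators below some `c (1 ⊗ σ)` form `s + t`, a compact convex set plus a closed convex
  -- cone. This sum is closed and convex, so a missing `M` can be separated from it.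
  set s := L '' {σ : Matrix k k ℂ | IsSubnormalized σ} with hs
  set t := {P : Matrix (a × k) (a × k) ℂ | (-P).PosSemidef} with ht
  have hsc : IsCompact s := isCompact_isSubnormalized.image hLc
  have htc : IsClosed t := isClosed_posSemidef.preimage continuous_neg
  have hsv : Convex ℝ s := IsSubnormalized.convex.linear_image L
  have htv : Convex ℝ t := by
    intro x hx y hy p q hp hq _
    have : -(p • x + q • y) = p • (-x) + q • (-y) := by module
    change (-(p • x + q • y)).PosSemidef
    rw [this]
    exact (Matrix.PosSemidef.smul hx hp).add (Matrix.PosSemidef.smul hy hq)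
  have hMn : M ∉ s + t := by
    rintro ⟨_, ⟨σ, hσ, rfl⟩, P, hP, hPM⟩
    refine hcon σ hσ (Matrix.le_iff.2 ?_)
    have : c • ((1 : Matrix a a ℂ) ⊗ₖ σ) - M = -P := by
      rw [← hPM]
      change _ - (c • ((1 : Matrix a a ℂ) ⊗ₖ σ) + P) = _
      abel
    rw [this]
    exact hP
  obtain ⟨f, u, hfu, huM⟩ := geometric_hahn_banach_closed_point (hsv.add htv)
    (htc.add_left_of_isCompact hsc) hMn
  have hf : ∀ σ : Matrix k k ℂ, IsSubnormalized σ → ∀ P : Matrix (a × k) (a × k) ℂ,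
      P.PosSemidef → f (c • ((1 : Matrix a a ℂ) ⊗ₖ σ)) - f P < u := by
    intro σ hσ P hP
    have := hfu _ (Set.add_mem_add (Set.mem_image_of_mem L hσ)
      (show -P ∈ t by simpa [ht] using hP))
    rw [map_add, map_neg] at this
    exact this
  have hu : 0 < u := by simpa using hf 0 IsSubnormalized.zero 0 Matrix.PosSemidef.zero
  have hfP : ∀ P : Matrix (a × k) (a × k) ℂ, P.PosSemidef → 0 ≤ f P := by
    -- A negative value of `f` on the cone could be scaled to violate the bound `u`.
    intro P hP
    by_contra hneg
    push Not at hneg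
    have h1 := hf 0 IsSubnormalized.zero ((u / (-f P)) • P)
      (hP.smul (div_nonneg hu.le (by linarith)))
    have h2 : (u / (-f P)) * f P = -u := by
      rw [div_mul_eq_mul_div, div_eq_iff (neg_ne_zero.2 hneg.ne)]
      ring
    rw [map_smul f (u / (-f P)), smul_eq_mul, h2] at h1
    simp at h1
  obtain ⟨E₀, hE₀⟩ := exists_re_trace_mul_eq f.toLinearMap
  set E := (1 / 2 : ℝ) • (E₀ + E₀ᴴ) with hE
  have hEH : E.IsHermitian := by
    simp [hE, Matrix.IsHermitian, Matrix.conjTranspose_smul, add_comm]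
  have hfE : ∀ X : Matrix (a × k) (a × k) ℂ, X.IsHermitian → f X = (E * X).trace.re := by
    intro X hX
    rw [hE, re_trace_hermitianPart_mul E₀ hX]
    exact hE₀ X
  have hEP : E.PosSemidef := posSemidef_of_re_nonneg hEH fun v => by
    have hv := Matrix.posSemidef_vecMulVec_self_star v
    rw [← trace_mul_vecMulVec, ← hfE _ hv.isHermitian]
    exact hfP _ hv
  -- Rescaled by `c / u`, the separating functional is dual feasible, as tests on rank-one states
  -- show; its value at `M` exceeds `c`, contradicting `h`.
  have hET : traceFirst ((c / u) • E) ≤ 1 := by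
    have hEu : ((c / u) • E).PosSemidef := hEP.smul (by positivity)
    rw [Matrix.le_iff]
    refine posSemidef_of_re_nonneg
      (Matrix.isHermitian_one.sub (traceFirst_posSemidef hEu).isHermitian) fun v => ?_
    rw [Matrix.sub_mulVec, dotProduct_sub, Complex.sub_re, Matrix.one_mulVec, sub_nonneg,
      ← trace_mul_vecMulVec, ← trace_mul_one_kronecker]
    have hvv : 0 ≤ (star v ⬝ᵥ v).re := (Complex.nonneg_iff.1 (dotProduct_star_self_nonneg v)).1
    have hP := Matrix.posSemidef_vecMulVec_self_star v
    have hPk := one_kronecker_posSemidef (a := a) hP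
    rw [Matrix.smul_mul, Matrix.trace_smul, Complex.smul_re, ← hfE _ hPk.isHermitian, smul_eq_mul]
    have key : ∀ r : ℝ, 0 ≤ r → r * (star v ⬝ᵥ v).re ≤ 1 →
        c * (r * f ((1 : Matrix a a ℂ) ⊗ₖ Matrix.vecMulVec v (star v))) < u := by
      intro r hr hr1
      have := hf _ (isSubnormalized_smul_vecMulVec v hr hr1) 0 Matrix.PosSemidef.zero
      rw [map_zero, sub_zero, Matrix.kronecker_smul, map_smul, map_smul] at this
      simpa using this
    rcases hvv.eq_or_lt with h0 | h0
    · have hv0 : v = 0 := by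
        have h1 : star v ⬝ᵥ v = 0 := by
          have h2 := Complex.nonneg_iff.1 (dotProduct_star_self_nonneg v)
          exact Complex.ext h0.symm h2.2.symm
        exact dotProduct_star_self_eq_zero.1 h1
      simp [hv0]
    · have h1 := key (star v ⬝ᵥ v).re⁻¹ (by positivity) (by rw [inv_mul_cancel₀ h0.ne'])
      rw [div_mul_eq_mul_div, div_le_iff₀ hu]
      have h2 := mul_le_mul_of_nonneg_left h1.le h0.le
      calc _ = (star v ⬝ᵥ v).re * (c * ((star v ⬝ᵥ v).re⁻¹ *
            f ((1 : Matrix a a ℂ) ⊗ₖ Matrix.vecMulVec v (star v)))) := by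
            field_simp
        _ ≤ _ := h2
  have h1 := h _ (hEP.smul (show 0 ≤ c / u by positivity)) hET
  rw [Matrix.smul_mul, Matrix.trace_smul, Complex.smul_re, ← hfE _ hM.isHermitian,
    smul_eq_mul, div_mul_eq_mul_div, div_le_iff₀ hu] at h1
  nlinarith

theorem conjTranspose_mul_self_dual (G : Matrix (a × k) l ℂ) :
    (reshape (dualEquiv a k l) G)ᴴ * reshape (dualEquiv a k l) G = (traceFirst (G * Gᴴ))ᵀ := by
  ext i j
  simp [reshape, dualEquiv, traceFirst, Matrix.mul_apply, Fintype.sum_prod_type, mul_comm]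

/-- A max-entropy bound for one marginal of a pure state bounds the min-entropy of the
complementary marginal. -/
theorem exists_dual_le_of_fidelity_sq_le (X : Matrix (a × b) k ℂ) {c : ℝ} (hc : 0 < c)
    (h : ∀ ω : Matrix b b ℂ, IsSubnormalized ω →
      fidelity (X * Xᴴ) ((1 : Matrix a a ℂ) ⊗ₖ ω) ^ 2 ≤ c) :
    ∃ σ : Matrix k k ℂ, IsSubnormalized σ ∧
      reshape (dualEquiv a b k) X * (reshape (dualEquiv a b k) X)ᴴ ≤
        c • ((1 : Matrix a a ℂ) ⊗ₖ σ) := by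
  set X' := reshape (dualEquiv a b k) X with hX'
  refine exists_le_smul_one_kronecker (Matrix.posSemidef_self_mul_conjTranspose X') hc
    fun E hE hE1 => ?_
  obtain ⟨G, hG⟩ : ∃ G : Matrix (a × k) (a × k) ℂ, G * Gᴴ = E :=
    ⟨_, sqrt_mul_conjTranspose_sqrt hE⟩
  -- Dual feasibility `traceFirst E ≤ 1` says exactly that this rearrangement of `G` is a
  -- contraction, hence a competitor in Uhlmann's theorem.
  set W := reshape (dualEquiv a k (a × k)) G with hWdef
  have hWG : reshape (dualEquiv a (a × k) k) W = G := rfl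
  have hW : IsContraction W := by
    rw [IsContraction, hWdef, conjTranspose_mul_self_dual, hG]
    rw [Matrix.le_iff] at hE1 ⊢
    simpa using hE1.transpose
  set Z := Gᴴ * X' with hZ
  have hv : (E * (X' * X'ᴴ)).trace.re = overlap Z Z := by
    rw [overlap_self_eq, hZ, ← hG, Matrix.mul_assoc, Matrix.trace_mul_comm,
      Matrix.conjTranspose_mul, Matrix.conjTranspose_conjTranspose]
    simp only [Matrix.mul_assoc]
  rw [hv]
  rcases (overlap_self_nonneg Z).eq_or_lt with h0 | h0
  · rw [← h0]; exact hc.le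
  set v := overlap Z Z with hvdef
  -- The normalized direction of `Z` gives equality in Cauchy–Schwarz, so the fidelity with `1 ⊗ T
  -- Tᴴ` is at least `√v`.
  set T : Matrix b (a × k) ℂ := ((Real.sqrt v)⁻¹ • Z)ᵀ with hT
  have hsq : Real.sqrt v * Real.sqrt v = v := Real.mul_self_sqrt h0.le
  have hs0 : 0 < Real.sqrt v := Real.sqrt_pos.2 h0
  have h2 : (Real.sqrt v)⁻¹ * v = Real.sqrt v := by
    rw [inv_mul_eq_div, div_eq_iff hs0.ne', hsq]
  have hT1 : overlap T T ≤ 1 := by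
    rw [hT, overlap_transpose, overlap_smul_left, overlap_smul_right, ← hvdef, h2,
      inv_mul_cancel₀ hs0.ne']
  have h1 := overlap_mul_le_fidelity X ((1 : Matrix a a ℂ) ⊗ₖ T) hW
  rw [one_kronecker_mul_conjTranspose, ← overlap_reshape (dualEquiv a b k), dual_kronecker_mul,
    hWG, overlap_mul_left, ← hX', ← hZ, hT, Matrix.transpose_transpose, overlap_smul_right,
    ← hvdef, ← hT, h2] at h1
  calc v = Real.sqrt v ^ 2 := by rw [sq, hsq]
    _ ≤ _ := pow_le_pow_left₀ hs0.le h1 2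
    _ ≤ c := h _ (isSubnormalized_mul_conjTranspose hT1)

end StrongDuality

/-! ### The choice `δ = 1 - √(1 - ε²)` -/

section ErrorTerm

theorem errorGap_pos {ε : ℝ} (hε : 0 < ε) : 0 < 1 - Real.sqrt (1 - ε ^ 2) := by
  have : Real.sqrt (1 - ε ^ 2) < 1 := by
    rw [Real.sqrt_lt' one_pos]
    nlinarith
  linarith

theorem two_rpow_errorTerm {ε : ℝ} (hε : 0 < ε) :
    (2 : ℝ) ^ errorTerm ε = (1 - Real.sqrt (1 - ε ^ 2))⁻¹ := by
  have := errorGap_pos hε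
  rw [errorTerm, Real.rpow_logb (by norm_num) (by norm_num) (by positivity), one_div]

/-- For `ε ≤ 1` this `δ` solves `1 - (1 - δ)² = ε²`. For `ε > 1` the real square root is `0`, so `δ
= 1` and the left side is `1`. -/
theorem sqrt_one_sub_errorGap_le {ε : ℝ} (hε : 0 < ε) :
    Real.sqrt (1 - (1 - (1 - Real.sqrt (1 - ε ^ 2))) ^ 2) ≤ ε := by
  refine Real.sqrt_le_iff.2 ⟨hε.le, ?_⟩
  rw [sub_sub_cancel]
  rcases le_total 0 (1 - ε ^ 2) with h | h
  · rw [Real.sq_sqrt h]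
    linarith
  · rw [Real.sqrt_eq_zero_of_nonpos h]
    linarith

end ErrorTerm

/-! ### Smooth duality and the chain rules -/

section ChainRules

variable {A B C : Type*} [Fintype A] [DecidableEq A] [Fintype B] [DecidableEq B]
  [Fintype C] [DecidableEq C]

theorem submatrix_mono {m n : Type*} {M N : Matrix n n ℂ} (h : M ≤ N) (f : m → n) :
    M.submatrix f f ≤ N.submatrix f f := by
  rw [Matrix.le_iff] at h ⊢
  exact h.submatrix f

theorem regroup_smul_one_kronecker (c : ℝ) (σ : Matrix C C ℂ) :
    regroup (c • ((1 : Matrix A A ℂ) ⊗ₖ ((1 : Matrix B B ℂ) ⊗ₖ σ))) =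
      c • ((1 : Matrix (A × B) (A × B) ℂ) ⊗ₖ σ) := by
  ext ⟨⟨i, j⟩, k⟩ ⟨⟨i', j'⟩, k'⟩
  by_cases h1 : i = i' <;> by_cases h2 : j = j' <;>
    simp [regroup, h1, h2]

theorem IsSubnormalized.submatrix {m n : Type*} [Fintype m] [Fintype n] {ρ : Matrix n n ℂ}
    (h : IsSubnormalized ρ) (e : m ≃ n) : IsSubnormalized (ρ.submatrix e e) := by
  refine ⟨h.1.submatrix e, ?_⟩
  have : (ρ.submatrix e e).trace = ρ.trace := by
    simpa [Matrix.trace] using Equiv.sum_comp e fun i => ρ i i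
  rw [this]
  exact h.2

/-- The change of reference operator is applied to `ρ'`, not `ρ`. Thus `ε''` is paid twice: between
the marginals of `ρ` and `ρ'`, and on returning from `ρ'` to `ρ`. -/
theorem exists_smooth_min_chain {ε ε' ε'' : ℝ} (hε : 0 < ε)
    {ρ ρ' : Matrix (A × B × C) (A × B × C) ℂ} (hρ : IsSubnormalized ρ)
    (hρ' : IsSubnormalized ρ') (hd' : purifiedDist ρ' ρ ≤ ε'')
    {τ : Matrix (B × C) (B × C) ℂ} (hτ : IsSubnormalized τ)
    (hd : purifiedDist τ (traceFirst ρ) ≤ ε')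
    {σ : Matrix (B × C) (B × C) ℂ} (hσ : IsSubnormalized σ) {l m : ℝ}
    (hl : ρ' ≤ ((2 : ℝ) ^ (-l)) • ((1 : Matrix A A ℂ) ⊗ₖ σ))
    {κ : Matrix C C ℂ} (hm : τ ≤ ((2 : ℝ) ^ (-m)) • ((1 : Matrix B B ℂ) ⊗ₖ κ)) :
    ∃ ω : Matrix (A × B × C) (A × B × C) ℂ, IsSubnormalized ω ∧
      purifiedDist ω ρ ≤ ε + ε' + 2 * ε'' ∧
      regroup ω ≤
        ((2 : ℝ) ^ (-(l + m - errorTerm ε))) • ((1 : Matrix (A × B) (A × B) ℂ) ⊗ₖ κ) := by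
  have hδ := errorGap_pos hε
  set δ := 1 - Real.sqrt (1 - ε ^ 2) with hδdef
  have hδ1 : δ ≤ 1 := by
    have := Real.sqrt_nonneg (1 - ε ^ 2)
    linarith
  obtain ⟨ω, hω, hle, hdist⟩ := exists_close_le_one_kronecker hρ' hσ
    (Real.rpow_nonneg (by norm_num) _) hl hτ hδ hδ1
  refine ⟨ω, hω, ?_, ?_⟩
  · have h1 := purifiedDist_triangle hω hρ' hρ
    have h2 := purifiedDist_triangle hτ hρ.traceFirst hρ'.traceFirst
    have h3 : purifiedDist (traceFirst ρ) (traceFirst ρ') ≤ ε'' := by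
      refine (purifiedDist_le_of_genFidelity_le
        (genFidelity_le_traceFirst hρ.1 hρ'.1)).trans ?_
      rw [purifiedDist_comm hρ.1 hρ'.1]
      exact hd'
    have h4 := sqrt_one_sub_errorGap_le hε
    rw [← hδdef] at h4
    linarith
  · have h1 := smul_mono_of_nonneg (c := (2 : ℝ) ^ (-l) / δ) (by positivity)
      (one_kronecker_mono (a := A) hm)
    have h2 := submatrix_mono (hle.trans h1) (Equiv.prodAssoc A B C)
    rw [Matrix.kronecker_smul, smul_smul] at h2
    refine h2.trans (le_of_eq ?_)
    have h3 : (2 : ℝ) ^ (-l) / δ * (2 : ℝ) ^ (-m) = (2 : ℝ) ^ (-(l + m - errorTerm ε)) := by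
      rw [show -(l + m - errorTerm ε) = -l + -m + errorTerm ε by ring,
        Real.rpow_add (by norm_num), Real.rpow_add (by norm_num), two_rpow_errorTerm hε, ← hδdef]
      ring
    rw [h3]
    exact regroup_smul_one_kronecker _ _

/-- Smooth duality: a max-entropy bound near one marginal of a pure state gives a min-entropy
bound near the complementary marginal. -/
theorem exists_smooth_min_of_max {a b k : Type*} [Fintype a] [DecidableEq a] [Fintype b]
    [DecidableEq b] [Fintype k] [DecidableEq k] {X : Matrix (a × b) k ℂ} (hX : overlap X X ≤ 1)
    {θ : Matrix (a × b) (a × b) ℂ} (hθ : IsSubnormalized θ) {c : ℝ} (hc : 0 < c)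
    (h : ∀ ω : Matrix b b ℂ, IsSubnormalized ω →
      fidelity θ ((1 : Matrix a a ℂ) ⊗ₖ ω) ^ 2 ≤ c) :
    ∃ (τ : Matrix (a × k) (a × k) ℂ) (σ : Matrix k k ℂ), IsSubnormalized τ ∧ IsSubnormalized σ ∧
      purifiedDist τ (reshape (dualEquiv a b k) X * (reshape (dualEquiv a b k) X)ᴴ) ≤
        purifiedDist θ (X * Xᴴ) ∧
      τ ≤ c • ((1 : Matrix a a ℂ) ⊗ₖ σ) := by
  -- Keeping the purifying system fixed only yields `Y Yᴴ ≤ θ`. This suffices, since the fidelity is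
  -- monotone.
  obtain ⟨Y, hY, hYF⟩ := exists_amplitude_le X hX hθ.1
  have hYY := Matrix.posSemidef_self_mul_conjTranspose Y
  obtain ⟨σ, hσ, hle⟩ := exists_dual_le_of_fidelity_sq_le Y hc fun ω hω => by
    have hk := one_kronecker_posSemidef (a := a) hω.1
    refine (pow_le_pow_left₀ (fidelity_nonneg _ _) ?_ 2).trans (h ω hω)
    rw [fidelity_comm hYY hk, fidelity_comm hθ.1 hk]
    exact fidelity_mono_right hk hYY hθ.1 hY
  refine ⟨_, σ, isSubnormalized_mul_conjTranspose ?_, hσ, ?_, hle⟩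
  · rw [overlap_reshape]
    exact overlap_self_le_one hθ hY
  · rw [purifiedDist_comm (Matrix.posSemidef_self_mul_conjTranspose _)
      (Matrix.posSemidef_self_mul_conjTranspose _),
      purifiedDist_comm hθ.1 (Matrix.posSemidef_self_mul_conjTranspose _)]
    apply purifiedDist_le_of_genFidelity_le
    refine hYF.trans ?_
    rw [← ampFidelity_reshape (dualEquiv a b k)]
    exact ampFidelity_le_genFidelity _ _

/-- Smooth duality: a min-entropy bound near one marginal of a pure state gives a max-entropy
bound near the complementary marginal. -/
theorem exists_smooth_max_of_min {a b k : Type*} [Fintype a] [DecidableEq a] [Fintype b]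
    [DecidableEq b] [Fintype k] [DecidableEq k] {X : Matrix (a × b) k ℂ} (hX : overlap X X ≤ 1)
    {τ : Matrix (a × k) (a × k) ℂ} (hτ : IsSubnormalized τ) {σ : Matrix k k ℂ}
    (hσ : IsSubnormalized σ) {c : ℝ} (hc : 0 ≤ c) (h : τ ≤ c • ((1 : Matrix a a ℂ) ⊗ₖ σ)) :
    ∃ υ : Matrix (a × b) (a × b) ℂ, IsSubnormalized υ ∧
      purifiedDist υ (X * Xᴴ) ≤
        purifiedDist τ (reshape (dualEquiv a b k) X * (reshape (dualEquiv a b k) X)ᴴ) ∧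
      ∀ ω : Matrix b b ℂ, IsSubnormalized ω →
        fidelity υ ((1 : Matrix a a ℂ) ⊗ₖ ω) ^ 2 ≤ c := by
  obtain ⟨Y, hY, hYF⟩ := exists_amplitude_le (reshape (dualEquiv a b k) X)
    (by rwa [overlap_reshape]) hτ.1
  have hYY : reshape (dualEquiv a b k) (reshape (dualEquiv a k b) Y) = Y := rfl
  have hXX : reshape (dualEquiv a k b) (reshape (dualEquiv a b k) X) = X := rfl
  refine ⟨_, isSubnormalized_mul_conjTranspose (X := reshape (dualEquiv a k b) Y) ?_, ?_,
    fun ω hω => fidelity_sq_le_of_dual_le _ hσ hc ?_ hω⟩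
  · rw [overlap_reshape]
    exact overlap_self_le_one hτ hY
  · rw [purifiedDist_comm (Matrix.posSemidef_self_mul_conjTranspose _)
      (Matrix.posSemidef_self_mul_conjTranspose _),
      purifiedDist_comm hτ.1 (Matrix.posSemidef_self_mul_conjTranspose _)]
    apply purifiedDist_le_of_genFidelity_le
    refine hYF.trans ?_
    rw [← ampFidelity_reshape (dualEquiv a k b), hXX]
    exact ampFidelity_le_genFidelity _ _
  · rw [hYY]
    exact hY.trans h

/-- The reordering of `(A ⊗ B) ⊗ K` as `B ⊗ (A ⊗ K)`. -/
def swapEquiv (A B K : Type*) : (A × B) × K ≃ B × A × K where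
  toFun p := (p.1.2, p.1.1, p.2)
  invFun p := ((p.2.1, p.1), p.2.2)
  left_inv _ := rfl
  right_inv _ := rfl

/-- Duality sends `A|BC` to `A|K` and `B|C` to `B|AK`. The min-entropy rule on `B ⊗ (A ⊗ K)` bounds
`BA|K`, which dualizes back to `AB|C`. The term `A|BC` becomes the second summand there, so `ε'` and
`ε''` trade places compared with the min-entropy rule. -/
theorem exists_smooth_max_chain {K : Type*} [Fintype K] [DecidableEq K] {ε ε' ε'' : ℝ}
    (hε : 0 < ε) {ρ ρ' : Matrix (A × B × C) (A × B × C) ℂ} (hρ : IsSubnormalized ρ)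
    {X : Matrix (A × B × C) K ℂ} (hX : X * Xᴴ = ρ)
    (hρ' : IsSubnormalized ρ') (hd' : purifiedDist ρ' ρ ≤ ε')
    {τ : Matrix (B × C) (B × C) ℂ} (hτ : IsSubnormalized τ)
    (hd : purifiedDist τ (traceFirst ρ) ≤ ε'') {p q : ℝ}
    (hp : ∀ ω : Matrix (B × C) (B × C) ℂ, IsSubnormalized ω →
      fidelity ρ' ((1 : Matrix A A ℂ) ⊗ₖ ω) ^ 2 ≤ (2 : ℝ) ^ p)
    (hq : ∀ ω : Matrix C C ℂ, IsSubnormalized ω →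
      fidelity τ ((1 : Matrix B B ℂ) ⊗ₖ ω) ^ 2 ≤ (2 : ℝ) ^ q) :
    ∃ υ : Matrix ((A × B) × C) ((A × B) × C) ℂ, IsSubnormalized υ ∧
      purifiedDist υ (regroup ρ) ≤ ε + ε' + 2 * ε'' ∧
      ∀ ω : Matrix C C ℂ, IsSubnormalized ω →
        fidelity υ ((1 : Matrix (A × B) (A × B) ℂ) ⊗ₖ ω) ^ 2 ≤
          (2 : ℝ) ^ (p + q + errorTerm ε) := by
  have hX1 : overlap X X ≤ 1 := overlap_self_le_one hρ hX.le
  set X₁ : Matrix (B × C) (A × K) ℂ := reshape (slideEquiv A (B × C) K) X with hX₁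
  have hX₁1 : overlap X₁ X₁ ≤ 1 := by rwa [hX₁, overlap_reshape]
  have hX₁X : X₁ * X₁ᴴ = traceFirst ρ := by rw [hX₁, slide_mul_conjTranspose, hX]
  set X₂ : Matrix (B × A × K) C ℂ := reshape (dualEquiv B C (A × K)) X₁ with hX₂
  have hX₂1 : IsSubnormalized (X₂ * X₂ᴴ) :=
    isSubnormalized_mul_conjTranspose (by rwa [hX₂, overlap_reshape])
  set X₃ : Matrix ((A × B) × C) K ℂ :=
    reshape ((Equiv.prodAssoc A B C).symm.prodCongr (Equiv.refl K)) X with hX₃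
  have hX₃1 : overlap X₃ X₃ ≤ 1 := by rwa [hX₃, overlap_reshape]
  have hX₃X : X₃ * X₃ᴴ = regroup ρ := by
    ext i j
    simp [← hX, hX₃, regroup, reshape, Matrix.mul_apply]
  obtain ⟨τ₁, σ₁, hτ₁, hσ₁, hd₁, hle₁⟩ :=
    exists_smooth_min_of_max hX1 hρ' (Real.rpow_pos_of_pos two_pos p) hp
  obtain ⟨τ₂, σ₂, hτ₂, hσ₂, hd₂, hle₂⟩ :=
    exists_smooth_min_of_max hX₁1 hτ (Real.rpow_pos_of_pos two_pos q) hq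
  rw [hX] at hd₁
  rw [hX₁X] at hd₂
  have hmarg : reshape (dualEquiv A (B × C) K) X * (reshape (dualEquiv A (B × C) K) X)ᴴ =
      traceFirst (X₂ * X₂ᴴ) := (slide_mul_conjTranspose X₂)
  rw [hmarg] at hd₁
  rw [← neg_neg p] at hle₁
  rw [← neg_neg q] at hle₂
  obtain ⟨κ, hκ, hdκ, hleκ⟩ := exists_smooth_min_chain hε hX₂1 hτ₂ (hd₂.trans hd) hτ₁
    (hd₁.trans hd') hσ₂ hle₂ hle₁
  have hle₃ : κ.submatrix (swapEquiv A B K) (swapEquiv A B K) ≤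
      ((2 : ℝ) ^ (p + q + errorTerm ε)) • ((1 : Matrix (A × B) (A × B) ℂ) ⊗ₖ σ₁) := by
    refine (submatrix_mono hleκ ((Equiv.prodComm A B).prodCongr (Equiv.refl K))).trans
      (le_of_eq ?_)
    have hexp : -(-q + -p - errorTerm ε) = p + q + errorTerm ε := by ring
    rw [hexp]
    ext ⟨⟨i, j⟩, k⟩ ⟨⟨i', j'⟩, k'⟩
    by_cases h1 : i = i' <;> by_cases h2 : j = j' <;> simp [h1, h2]
  obtain ⟨υ, hυ, hdυ, hF⟩ := exists_smooth_max_of_min hX₃1 (hκ.submatrix (swapEquiv A B K)) hσ₁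
    (Real.rpow_nonneg two_pos.le _) hle₃
  refine ⟨υ, hυ, ?_, hF⟩
  rw [hX₃X] at hdυ
  have hswap : reshape (dualEquiv (A × B) C K) X₃ * (reshape (dualEquiv (A × B) C K) X₃)ᴴ =
      (X₂ * X₂ᴴ).submatrix (swapEquiv A B K) (swapEquiv A B K) := by
    ext i j
    simp [hX₃, hX₂, hX₁, reshape, Matrix.mul_apply, dualEquiv, slideEquiv, swapEquiv]
  rw [hswap] at hdυ
  exact hdυ.trans ((purifiedDist_le_of_genFidelity_le
    (genFidelity_le_submatrix (swapEquiv A B K) hκ.1 hX₂1.1)).trans hdκ)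

theorem log2_le_coe_iff {x r : ℝ} : log2 x ≤ (r : EReal) ↔ x ≤ (2 : ℝ) ^ r := by
  unfold log2
  split_ifs with h
  · rw [EReal.coe_le_coe_iff, Real.logb_le_iff_le_rpow (by norm_num) h]
  · simp only [bot_le, true_iff]
    exact (not_lt.1 h).trans (Real.rpow_nonneg (by norm_num) _)

theorem maxEntropy_le_coe_iff {ρ : Matrix (A × B) (A × B) ℂ} {r : ℝ} :
    maxEntropy ρ ≤ (r : EReal) ↔ ∀ ω : Matrix B B ℂ, IsSubnormalized ω →
      fidelity ρ ((1 : Matrix A A ℂ) ⊗ₖ ω) ^ 2 ≤ (2 : ℝ) ^ r := by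
  simp only [maxEntropy, sSup_le_iff]
  constructor
  · exact fun h ω hω => log2_le_coe_iff.1 (h _ ⟨ω, hω, rfl⟩)
  · rintro h _ ⟨ω, hω, rfl⟩
    exact log2_le_coe_iff.2 (h ω hω)

/-- Needed to exclude sums `⊤ + ⊥` in the max-entropy rule. The `+ 1` keeps the logarithm's argument
positive when `A` is empty. -/
theorem maxEntropy_ne_top {ρ : Matrix (A × B) (A × B) ℂ} (hρ : IsSubnormalized ρ) :
    maxEntropy ρ ≠ ⊤ := by
  suffices h : maxEntropy ρ ≤ (Real.logb 2 (Fintype.card A + 1) : EReal) from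
    ne_top_of_le_ne_top (EReal.coe_ne_top _) h
  rw [maxEntropy_le_coe_iff]
  intro ω hω
  rw [Real.rpow_logb (by norm_num) (by norm_num) (by positivity)]
  refine (fidelity_sq_le hρ.1 (one_kronecker_posSemidef hω.1)).trans ?_
  have h1 : ((1 : Matrix A A ℂ) ⊗ₖ ω).trace.re = Fintype.card A * ω.trace.re := by
    simp [Matrix.trace_kronecker]
  have h2 := re_trace_nonneg hω.1
  have h3 := hω.2
  have h4 := hρ.2
  have h5 := re_trace_nonneg hρ.1
  have h6 : (0 : ℝ) ≤ Fintype.card A := by positivity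
  rw [h1]
  have h7 : Fintype.card A * ω.trace.re ≤ Fintype.card A := by nlinarith
  calc _ ≤ 1 * (Fintype.card A : ℝ) := by gcongr
    _ ≤ _ := by linarith

theorem smoothMaxEntropy_ne_top {ε : ℝ} (hε : 0 ≤ ε) {ρ : Matrix (A × B) (A × B) ℂ}
    (hρ : IsSubnormalized ρ) : smoothMaxEntropy ε ρ ≠ ⊤ :=
  ne_top_of_le_ne_top (maxEntropy_ne_top hρ)
    (sInf_le ⟨ρ, hρ, by rw [purifiedDist_self hρ]; exact hε, rfl⟩)

theorem exists_of_smoothMaxEntropy_lt {ε : ℝ} {ρ : Matrix (A × B) (A × B) ℂ} {r : ℝ}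
    (h : smoothMaxEntropy ε ρ < r) :
    ∃ τ, IsSubnormalized τ ∧ purifiedDist τ ρ ≤ ε ∧ ∀ ω : Matrix B B ℂ, IsSubnormalized ω →
      fidelity τ ((1 : Matrix A A ℂ) ⊗ₖ ω) ^ 2 ≤ (2 : ℝ) ^ r := by
  obtain ⟨_, ⟨τ, hτ, hd, rfl⟩, hlt⟩ := sInf_lt_iff.1 h
  exact ⟨τ, hτ, hd, maxEntropy_le_coe_iff.1 hlt.le⟩

theorem smoothMaxEntropy_le_coe {ε : ℝ} {ρ τ : Matrix (A × B) (A × B) ℂ} {r : ℝ}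
    (hτ : IsSubnormalized τ) (hd : purifiedDist τ ρ ≤ ε)
    (h : ∀ ω : Matrix B B ℂ, IsSubnormalized ω →
      fidelity τ ((1 : Matrix A A ℂ) ⊗ₖ ω) ^ 2 ≤ (2 : ℝ) ^ r) :
    smoothMaxEntropy ε ρ ≤ r := by
  have h1 : smoothMaxEntropy ε ρ ≤ maxEntropy τ := sInf_le ⟨τ, hτ, hd, rfl⟩
  exact h1.trans (maxEntropy_le_coe_iff.2 h)

theorem exists_of_lt_smoothMinEntropy {ε : ℝ} {ρ : Matrix (A × B) (A × B) ℂ} {x : EReal}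
    (h : x < smoothMinEntropy ε ρ) :
    ∃ (τ : Matrix (A × B) (A × B) ℂ) (σ : Matrix B B ℂ) (l : ℝ), IsSubnormalized τ ∧
      IsSubnormalized σ ∧ purifiedDist τ ρ ≤ ε ∧ x < l ∧
      τ ≤ ((2 : ℝ) ^ (-l)) • ((1 : Matrix A A ℂ) ⊗ₖ σ) := by
  obtain ⟨_, ⟨τ, hτ, hd, rfl⟩, h1⟩ := lt_sSup_iff.1 h
  obtain ⟨_, ⟨σ, hσ, rfl⟩, h2⟩ := lt_sSup_iff.1 h1
  obtain ⟨_, ⟨l, hl, rfl⟩, h3⟩ := lt_sSup_iff.1 h2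
  exact ⟨τ, σ, l, hτ, hσ, hd, h3, hl⟩

theorem coe_le_smoothMinEntropy {ε : ℝ} {ρ τ : Matrix (A × B) (A × B) ℂ} {σ : Matrix B B ℂ}
    {l : ℝ} (hτ : IsSubnormalized τ) (hσ : IsSubnormalized σ) (hd : purifiedDist τ ρ ≤ ε)
    (h : τ ≤ ((2 : ℝ) ^ (-l)) • ((1 : Matrix A A ℂ) ⊗ₖ σ)) :
    (l : EReal) ≤ smoothMinEntropy ε ρ := by
  have h1 : (l : EReal) ≤ minEntropyRel τ σ := le_sSup ⟨l, h, rfl⟩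
  have h2 : minEntropyRel τ σ ≤ minEntropy τ := le_sSup ⟨σ, hσ, rfl⟩
  exact h1.trans (h2.trans (le_sSup ⟨τ, hτ, hd, rfl⟩))

theorem smoothMinEntropy_chain {ε ε' ε'' : ℝ} (hε : 0 < ε)
    {ρ : Matrix (A × B × C) (A × B × C) ℂ} (hρ : IsSubnormalized ρ) :
    smoothMinEntropy ε'' ρ + smoothMinEntropy ε' (traceFirst ρ) - (errorTerm ε : EReal) ≤
      smoothMinEntropy (ε + ε' + 2 * ε'') (regroup ρ) := by
  rw [EReal.sub_le_iff_le_add (Or.inl (EReal.coe_ne_bot _)) (Or.inl (EReal.coe_ne_top _))]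
  -- Arguing strictly below both suprema avoids attainment and covers infinite values.
  refine EReal.add_le_of_forall_lt fun x hx y hy => ?_
  obtain ⟨ρ', σ, l, hρ', hσ, hd', hxl, hl⟩ := exists_of_lt_smoothMinEntropy hx
  obtain ⟨τ, κ, m, hτ, hκ, hd, hym, hm⟩ := exists_of_lt_smoothMinEntropy hy
  obtain ⟨ω, hω, hdω, hle⟩ := exists_smooth_min_chain hε hρ hρ' hd' hτ hd hσ hl hm
  have h := coe_le_smoothMinEntropy (ρ := regroup ρ) (hω.submatrix (Equiv.prodAssoc A B C)) hκ
    ((purifiedDist_le_of_genFidelity_le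
      (genFidelity_le_submatrix (Equiv.prodAssoc A B C) hω.1 hρ.1)).trans hdω) hle
  calc x + y ≤ (l : EReal) + (m : EReal) := add_le_add hxl.le hym.le
    _ = ((l + m - errorTerm ε : ℝ) : EReal) + (errorTerm ε : EReal) := by
      rw [← EReal.coe_add, ← EReal.coe_add, sub_add_cancel]
    _ ≤ _ := by gcongr

theorem smoothMaxEntropy_chain {ε ε' ε'' : ℝ} (hε : 0 < ε) (hε' : 0 ≤ ε') (hε'' : 0 ≤ ε'')
    {ρ : Matrix (A × B × C) (A × B × C) ℂ} (hρ : IsSubnormalized ρ) :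
    smoothMaxEntropy (ε + ε' + 2 * ε'') (regroup ρ) ≤
      smoothMaxEntropy ε' ρ + smoothMaxEntropy ε'' (traceFirst ρ) + (errorTerm ε : EReal) := by
  rw [← EReal.sub_le_iff_le_add (Or.inl (EReal.coe_ne_bot _)) (Or.inl (EReal.coe_ne_top _))]
  refine EReal.le_add_of_forall_gt (Or.inr (smoothMaxEntropy_ne_top hε'' hρ.traceFirst))
    (Or.inl (smoothMaxEntropy_ne_top hε' hρ)) fun x hx y hy => ?_
  -- Real exponents are inserted because strong duality needs a positive bound `2 ^ p`, even when
  -- the entropy is `⊥`.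
  obtain ⟨p, hp, hpx⟩ := EReal.lt_iff_exists_real_btwn.1 hx
  obtain ⟨q, hq, hqy⟩ := EReal.lt_iff_exists_real_btwn.1 hy
  obtain ⟨ρ', hρ', hd', hF'⟩ := exists_of_smoothMaxEntropy_lt hp
  obtain ⟨τ, hτ, hd, hF⟩ := exists_of_smoothMaxEntropy_lt hq
  obtain ⟨υ, hυ, hdυ, hFυ⟩ := exists_smooth_max_chain hε hρ
    (sqrt_mul_conjTranspose_sqrt hρ.1) hρ' hd' hτ hd hF' hF
  have h := smoothMaxEntropy_le_coe hυ hdυ hFυ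
  rw [EReal.sub_le_iff_le_add (Or.inl (EReal.coe_ne_bot _)) (Or.inl (EReal.coe_ne_top _))]
  calc _ ≤ _ := h
    _ = (p : EReal) + (q : EReal) + (errorTerm ε : EReal) := by
      rw [← EReal.coe_add, ← EReal.coe_add]
    _ ≤ x + y + (errorTerm ε : EReal) := by
      gcongr

end ChainRules

end SmoothEntropy

theorem mainTheorem1 {A B C : Type*} [Fintype A] [DecidableEq A] [Fintype B] [DecidableEq B]
    [Fintype C] [DecidableEq C] (ε ε' ε'' : ℝ) (hε : 0 < ε) (hε' : 0 ≤ ε') (hε'' : 0 ≤ ε'')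
    (ρ : Matrix (A × B × C) (A × B × C) ℂ) (hρ : SmoothEntropy.IsSubnormalized ρ) :
    SmoothEntropy.smoothMinEntropy (ε + ε' + 2 * ε'') (SmoothEntropy.regroup ρ) ≥
        SmoothEntropy.smoothMinEntropy ε'' ρ
          + SmoothEntropy.smoothMinEntropy ε' (SmoothEntropy.traceFirst ρ)
          - ((SmoothEntropy.errorTerm ε : ℝ) : EReal) ∧
      SmoothEntropy.smoothMaxEntropy (ε + ε' + 2 * ε'') (SmoothEntropy.regroup ρ) ≤
        SmoothEntropy.smoothMaxEntropy ε' ρ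
          + SmoothEntropy.smoothMaxEntropy ε'' (SmoothEntropy.traceFirst ρ)
          + ((SmoothEntropy.errorTerm ε : ℝ) : EReal) :=
  ⟨SmoothEntropy.smoothMinEntropy_chain hε hρ,
    SmoothEntropy.smoothMaxEntropy_chain hε hε' hε'' hρ⟩
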